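/- Let $G=(V,E)$ be a connected, infinite, locally finite, simple graph with a distinguished root vertex $\mathbf 1$. Let $h:V\to\mathbb Z$ and let $\mathcal H\le\operatorname{Aut}(G)$ be such that $(h,\mathcal H)$ is a unimodular graph height function, that is: (a) $h(\mathbf 1)=0$; (b) $\mathcal H$ has finitely many orbits on $V$ (so that $G$ is quasi-transitive), and $h(\alpha v)-h(\alpha u)=h(v)-h(u)$ for all $\alpha\in\mathcal H$ and $u,v\in V$; (c) every $v\in V$ has neighbours $u,w$ with $h(u)<h(v)<h(w)$; (d) $|\operatorname{Stab}_u v|=|\operatorname{Stab}_v u|$ for all $u,v$ in the same orbit of $\mathcal H$, where $\operatorname{Stab}_u v=\{\alpha v:\alpha\in\mathcal H,\ \alpha u=u\}$. Let $\phi:E\to(0,\infty)$ be $\mathcal H$-invariant: $\phi(\langle\alpha u,\alpha v\rangle)=\phi(\langle u,v\rangle)$ for every edge $\langle u,v\rangle$ and every $\alpha\in\mathcal H$. An $n$-step self-avoiding walk (SAW) from $v$ is a sequence $\pi=(\pi_0,\dots,\pi_n)$ of distinct vertices with $\pi_0=v$ and consecutive vertices adjacent. Its weight is $w(\pi)=\prod_{i=1}^n\phi(\langle\pi_{i-1},\pi_i\rangle)$,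 and the weight of a finite set of SAWs is the sum of the weights of its members. The SAW $\pi$ is a bridge if $h(\pi_0)<h(\pi_i)\le h(\pi_n)$ for $1\le i\le n$. Let $\Sigma_n$ be the set of $n$-step SAWs from $\mathbf 1$, let $\beta_n(v)$ be the set of $n$-step bridges from $v$, and put $w(\beta_n)=\min_{v\in V}w(\beta_n(v))$. Then the limits $$\mu=\lim_{n\to\infty}w(\Sigma_n)^{1/n},\qquad \beta=\lim_{n\to\infty}w(\beta_n)^{1/n}$$ (the weighted connective constant and the weighted bridge constant) exist, $\mu\in(0,\infty)$, and $\beta=\mu$. -/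

import Mathlib

open Filter Topology

/-!
Weighted self-avoiding walks on a simple graph `G` on `V`.  An `n`-step SAW is a Mathlib walk that
is a path and has length `n`.  An edge weight is a function on `Sym2 V`, of which only the values on
edges of `G` are ever used.
-/

namespace WeightedSAW

variable {V : Type*}

/-- A subgroup `H` of `Aut(G)` acts quasi-transitively: it has finitely many orbits on `V`. -/
def ActsQuasiTransitively (G : SimpleGraph V) (H : Subgroup (G ≃g G)) : Prop :=
  Finite (MulAction.orbitRel.Quotient H V)

/-- The action of `H` on `V` is unimodular: `|Stab_u v| = |Stab_v u|` whenever `u`, `v` lie in the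
same orbit of `H`, where `Stab_u v` is the orbit of `v` under the stabilizer of `u` in `H`. -/
def ActsUnimodularly (G : SimpleGraph V) (H : Subgroup (G ≃g G)) : Prop :=
  ∀ u v : V, v ∈ MulAction.orbit H u →
    (MulAction.orbit (MulAction.stabilizer H u) v).encard =
      (MulAction.orbit (MulAction.stabilizer H v) u).encard

/-- `(h, H)` is a graph height function on the graph `G` with root `root`. -/
structure IsGraphHeightFunction (G : SimpleGraph V) (root : V) (h : V → ℤ)
    (H : Subgroup (G ≃g G)) : Prop where
  map_root : h root = 0
  quasiTransitive : ActsQuasiTransitively G H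
  differenceInvariant : ∀ α ∈ H, ∀ u v : V, h (α v) - h (α u) = h v - h u
  exists_lower_upper : ∀ v : V, ∃ u w : V, G.Adj v u ∧ G.Adj v w ∧ h u < h v ∧ h v < h w

/-- A graph height function `(h, H)` such that the action of `H` is unimodular. -/
structure IsUnimodularGraphHeightFunction (G : SimpleGraph V) (root : V) (h : V → ℤ)
    (H : Subgroup (G ≃g G)) : Prop extends IsGraphHeightFunction G root h H where
  unimodular : ActsUnimodularly G H

/-- `φ` is a positive, `H`-invariant weight on the edges of `G`. -/
structure IsInvariantEdgeWeight (G : SimpleGraph V) (H : Subgroup (G ≃g G))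
    (φ : Sym2 V → ℝ) : Prop where
  pos : ∀ e ∈ G.edgeSet, 0 < φ e
  invariant : ∀ α ∈ H, ∀ u v : V, G.Adj u v → φ s(α u, α v) = φ s(u, v)

/-- The weight of a walk is the product of the weights of its edges. -/
def walkWeight {G : SimpleGraph V} (φ : Sym2 V → ℝ) {u v : V} (p : G.Walk u v) : ℝ :=
  (p.edges.map φ).prod

/-- The set of `n`-step self-avoiding walks from `v` (with arbitrary final vertex). -/
def saws (G : SimpleGraph V) (n : ℕ) (v : V) : Set (Σ w : V, G.Walk v w) :=
  {p | p.2.IsPath ∧ p.2.length = n}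

/-- A walk `π` is a bridge if `h π₀ < h πᵢ ≤ h πₙ` for `1 ≤ i ≤ n`. -/
def IsBridge {G : SimpleGraph V} (h : V → ℤ) {u v : V} (p : G.Walk u v) : Prop :=
  ∀ x ∈ p.support.tail, h u < h x ∧ h x ≤ h v

/-- The set of `n`-step bridges from `v`. -/
def bridges (G : SimpleGraph V) (h : V → ℤ) (n : ℕ) (v : V) : Set (Σ w : V, G.Walk v w) :=
  {p | p ∈ saws G n v ∧ IsBridge h p.2}

/-- The total weight of a set of walks from `v`.  It is used for finite sets only, see
`saws_finite` and `bridges_finite`. -/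
noncomputable def totalWeight {G : SimpleGraph V} (φ : Sym2 V → ℝ) {v : V}
    (S : Set (Σ w : V, G.Walk v w)) : ℝ :=
  ∑' p : S, walkWeight φ p.1.2

theorem walks_finite (G : SimpleGraph V) [G.LocallyFinite] (n : ℕ) :
    ∀ v : V, {p : Σ w : V, G.Walk v w | p.2.length = n}.Finite := by
  induction n with
  | zero =>
    intro v
    refine (Set.finite_singleton (⟨v, SimpleGraph.Walk.nil⟩ : Σ w : V, G.Walk v w)).subset ?_
    rintro ⟨w, p⟩ hp
    cases p with
    | nil => rfl
    | cons _ _ => simp at hp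
  | succ n ih =>
    intro v
    have hf : (⋃ x : G.neighborSet v, (fun q : Σ w : V, G.Walk (x : V) w =>
        (⟨q.1, SimpleGraph.Walk.cons x.2 q.2⟩ : Σ w : V, G.Walk v w)) ''
          {q | q.2.length = n}).Finite :=
      Set.finite_iUnion fun x => (ih x).image _
    refine hf.subset ?_
    rintro ⟨w, p⟩ hp
    cases p with
    | nil => simp at hp
    | @cons _ x _ hx q =>
      refine Set.mem_iUnion.2 ⟨⟨x, hx⟩, ⟨w, q⟩, ?_, rfl⟩
      simpa using hp

theorem saws_finite (G : SimpleGraph V) [G.LocallyFinite] (n : ℕ) (v : V) :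
    (saws G n v).Finite :=
  (walks_finite G n v).subset fun _ hp => hp.2

theorem bridges_finite (G : SimpleGraph V) [G.LocallyFinite] (h : V → ℤ) (n : ℕ) (v : V) :
    (bridges G h n v).Finite :=
  (saws_finite G n v).subset fun _ hp => hp.1

/-- The weight of the `n`-step SAWs from the root. -/
noncomputable def sawWeight (G : SimpleGraph V) (φ : Sym2 V → ℝ) (root : V) (n : ℕ) : ℝ :=
  totalWeight φ (saws G n root)

/-- The minimum over all vertices `v` of the weight of the `n`-step bridges from `v`.  (For an
invariant weight this weight depends only on the orbit of `v`, so the infimum is attained.) -/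
noncomputable def bridgeWeight (G : SimpleGraph V) (φ : Sym2 V → ℝ) (h : V → ℤ) (n : ℕ) : ℝ :=
  ⨅ v : V, totalWeight φ (bridges G h n v)

/-- The weighted connective constant, as a limit. -/
noncomputable def connectiveConstant (G : SimpleGraph V) (φ : Sym2 V → ℝ) (root : V) : ℝ :=
  limUnder atTop fun n : ℕ => sawWeight G φ root n ^ (1 / (n : ℝ))

/-- The weighted bridge constant, as a limit. -/
noncomputable def bridgeConstant (G : SimpleGraph V) (φ : Sym2 V → ℝ) (h : V → ℤ) : ℝ :=
  limUnder atTop fun n : ℕ => bridgeWeight G φ h n ^ (1 / (n : ℝ))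

end WeightedSAW

/-! Concatenating bridges gives a bridge, so the minimal bridge weights are supermultiplicative.
Fekete's lemma (`exists_tendsto_root_of_supermultiplicative`) gives their root limit `β` together
with the bound `β ^ n`. Bridges from the root are SAWs, so the SAW weights lie above. It remains to
show that `z ^ n * sawWeight` is bounded in `n` whenever `z * β < 1`; then `tendsto_root_of_le`
squeezes the SAW roots to the same limit, and no submultiplicativity of SAW weights is needed. The
factor `z` is absorbed into the edge weight.

With that scaled weight the minimal `n`-step bridge weight is at most `(z * β) ^ n`. Any vertex can
be joined to any orbit by a bridge of bounded length, so bridge weights from all vertices decay at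
this rate, and the bridges from a vertex have bounded total weight
(`exists_sawWeight_le_of_bridgeWeight_le`). This is passed on to SAWs by a form of the
Hammersley–Welsh argument. Cutting a half-space walk at its last highest vertex leaves a bridge and
a half-space walk for `-h` of smaller span. Iterating bounds half-space walks by a product of
factors `1 + s t`, with `s t` the weight of upward and downward bridges of span `t + 1`; the product
converges because `s` is summable (`exists_outWeight_halfSpace_le`). A SAW cut at its last lowest
vertex is a reversed walk followed by a half-space walk.

Downward bridges and the reversed first piece are walks that must be counted from their other end.
Unimodularity makes this possible: the mass transport principle (`exists_tsum_le_mul_iSup_tsum`)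
bounds the weight of walks into a vertex by a constant times the largest weight of walks out of a
vertex. -/

namespace WeightedSAW

open scoped ENNReal

open SimpleGraph (Walk)

variable {V : Type*} {G : SimpleGraph V}

/-! ### Weights of classes of walks, with values in `[0, ∞]` -/

/-- A property of walks, for all endpoints at once. -/
abbrev WalkProp (G : SimpleGraph V) := ∀ ⦃u v : V⦄, G.Walk u v → Prop

/-- The weight of a walk, as an extended nonnegative real. -/
noncomputable def ewt (φ : Sym2 V → ℝ) {u v : V} (p : G.Walk u v) : ℝ≥0∞ :=
  ENNReal.ofReal (walkWeight φ p)

/-- The total weight of the walks from `u` to `v` that satisfy `P`. -/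
noncomputable def pairWeight (φ : Sym2 V → ℝ) (P : WalkProp G) (u v : V) : ℝ≥0∞ :=
  ∑' p : {p : G.Walk u v // P p}, ewt φ p.1

/-- The total weight of the walks from `u` that satisfy `P`. -/
noncomputable def outWeight (φ : Sym2 V → ℝ) (P : WalkProp G) (u : V) : ℝ≥0∞ :=
  ∑' v, pairWeight φ P u v

/-- The relation need only recover `a` from `b`; this replaces injectivity of an explicit map and
avoids equalities between walks with different endpoints. -/
theorem tsum_subtype_le_of_rel {α β : Type*} {P : α → Prop} {Q : β → Prop} {f : α → ℝ≥0∞}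
    {g : β → ℝ≥0∞} (rel : α → β → Prop) (h : ∀ a, P a → ∃ b, Q b ∧ rel a b ∧ f a ≤ g b)
    (hr : ∀ a a' b, P a → P a' → rel a b → rel a' b → a = a') :
    ∑' a : {a // P a}, f a ≤ ∑' b : {b // Q b}, g b := by
  choose i hQ hrel hle using h
  let j : {a // P a} → {b // Q b} := fun a => ⟨i a.1 a.2, hQ _ _⟩
  have hj : Function.Injective j := by
    intro a b hab
    have hab' : i a.1 a.2 = i b.1 b.2 := congrArg Subtype.val hab
    exact Subtype.ext (hr _ _ _ a.2 b.2 (hrel _ a.2) (hab' ▸ hrel _ b.2))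
  calc ∑' a : {a // P a}, f a ≤ ∑' a, g (j a) := ENNReal.tsum_le_tsum fun a => hle _ _
    _ ≤ _ := ENNReal.tsum_comp_le_tsum_of_injective hj (fun b : {b // Q b} => g b)

theorem pairWeight_eq_indicator (φ : Sym2 V → ℝ) (P : WalkProp G) (u v : V) :
    pairWeight φ P u v =
      ∑' p : G.Walk u v, {p : G.Walk u v | P p}.indicator (fun p => ewt φ p) p :=
  tsum_subtype {p : G.Walk u v | P p} (fun p => ewt φ p)

theorem tsum_sigma_subtype {ι : Type*} {β : ι → Type*} (Q : ∀ i, β i → Prop)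
    (f : ∀ i, β i → ℝ≥0∞) :
    ∑' b : {b : Σ i, β i // Q b.1 b.2}, f b.1.1 b.1.2 =
      ∑' i, ∑' b : {b : β i // Q i b}, f i b.1 := by
  have h1 := tsum_subtype {b : Σ i, β i | Q b.1 b.2} (fun b => f b.1 b.2)
  refine h1.trans ?_
  rw [ENNReal.tsum_sigma']
  refine tsum_congr fun i => ?_
  have h2 := tsum_subtype {b : β i | Q i b} (fun b => f i b)
  refine Eq.trans ?_ h2.symm
  rfl

theorem outWeight_eq (φ : Sym2 V → ℝ) (P : WalkProp G) (u : V) :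
    outWeight φ P u = ∑' p : {p : Σ v, G.Walk u v // P p.2}, ewt φ p.1.2 :=
  (tsum_sigma_subtype (fun _ (p : G.Walk u _) => P p) (fun _ p => ewt φ p)).symm

theorem tsum_pairWeight_left_eq (φ : Sym2 V → ℝ) (P : WalkProp G) (v : V) :
    ∑' u, pairWeight φ P u v = ∑' p : {p : Σ u, G.Walk u v // P p.2}, ewt φ p.1.2 :=
  (tsum_sigma_subtype (fun _ (p : G.Walk _ v) => P p) (fun _ p => ewt φ p)).symm

theorem tsum_subtype_prod {α β : Type*} (P : α → Prop) (Q : β → Prop) (f : α → ℝ≥0∞)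
    (g : β → ℝ≥0∞) :
    ∑' b : {b : α × β // P b.1 ∧ Q b.2}, f b.1.1 * g b.1.2 =
      (∑' a : {a // P a}, f a) * ∑' b : {b // Q b}, g b := by
  rw [← (Equiv.subtypeProdEquivProd (p := P) (q := Q)).symm.tsum_eq, ENNReal.tsum_prod',
    ← ENNReal.tsum_mul_right]
  refine tsum_congr fun a => ?_
  rw [← ENNReal.tsum_mul_left]
  rfl

theorem tsum_pairWeight_mul_eq (φ : Sym2 V → ℝ) (P Q : WalkProp G) (u v : V) :
    ∑' x, pairWeight φ P u x * pairWeight φ Q x v =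
      ∑' b : {b : Σ x, G.Walk u x × G.Walk x v // P b.2.1 ∧ Q b.2.2},
        ewt φ b.1.2.1 * ewt φ b.1.2.2 := by
  rw [tsum_sigma_subtype (fun x (b : G.Walk u x × G.Walk x v) => P b.1 ∧ Q b.2)
    (fun x b => ewt φ b.1 * ewt φ b.2)]
  refine tsum_congr fun x => ?_
  exact (tsum_subtype_prod (fun p : G.Walk u x => P p) (fun p : G.Walk x v => Q p)
    (fun p => ewt φ p) (fun p => ewt φ p)).symm

theorem walkWeight_nonneg {φ : Sym2 V → ℝ} (hφ : ∀ e ∈ G.edgeSet, 0 < φ e) {u v : V}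
    (p : G.Walk u v) : 0 ≤ walkWeight φ p := by
  refine List.prod_nonneg fun a ha => ?_
  obtain ⟨e, he, rfl⟩ := List.mem_map.1 ha
  exact (hφ e (p.edges_subset_edgeSet he)).le

theorem walkWeight_append (φ : Sym2 V → ℝ) {u v w : V} (p : G.Walk u v) (q : G.Walk v w) :
    walkWeight φ (p.append q) = walkWeight φ p * walkWeight φ q := by
  simp [walkWeight, SimpleGraph.Walk.edges_append]

theorem ewt_append {φ : Sym2 V → ℝ} (hφ : ∀ e ∈ G.edgeSet, 0 < φ e) {u v w : V}
    (p : G.Walk u v) (q : G.Walk v w) : ewt φ (p.append q) = ewt φ p * ewt φ q := by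
  rw [ewt, walkWeight_append, ENNReal.ofReal_mul (walkWeight_nonneg hφ p)]; rfl

theorem ewt_cons {φ : Sym2 V → ℝ} (hφ : ∀ e ∈ G.edgeSet, 0 < φ e) {u v w : V}
    (h : G.Adj u v) (q : G.Walk v w) :
    ewt φ (SimpleGraph.Walk.cons h q) = ENNReal.ofReal (φ s(u, v)) * ewt φ q := by
  rw [ewt, ewt, ← ENNReal.ofReal_mul (hφ _ h).le]
  simp [walkWeight]

theorem ewt_reverse (φ : Sym2 V → ℝ) {u v : V} (p : G.Walk u v) :
    ewt φ p.reverse = ewt φ p := by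
  simp [ewt, walkWeight, SimpleGraph.Walk.edges_reverse, List.prod_reverse]

theorem pairWeight_mono (φ : Sym2 V → ℝ) {P Q : WalkProp G} {u v : V}
    (h : ∀ p : G.Walk u v, P p → Q p) : pairWeight φ P u v ≤ pairWeight φ Q u v :=
  tsum_subtype_le_of_rel (fun p q => p = q) (fun p hp => ⟨p, h p hp, rfl, le_rfl⟩)
    (fun _ _ _ _ _ h1 h2 => h1.trans h2.symm)

theorem outWeight_mono (φ : Sym2 V → ℝ) {P Q : WalkProp G} {u : V}
    (h : ∀ v, ∀ p : G.Walk u v, P p → Q p) : outWeight φ P u ≤ outWeight φ Q u :=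
  ENNReal.tsum_le_tsum fun v => pairWeight_mono φ (h v)

theorem pairWeight_or_le (φ : Sym2 V → ℝ) (P Q : WalkProp G) (u v : V) :
    pairWeight φ (fun _ _ p => P p ∨ Q p) u v ≤ pairWeight φ P u v + pairWeight φ Q u v := by
  simp only [pairWeight_eq_indicator, ← ENNReal.tsum_add]
  refine ENNReal.tsum_le_tsum fun p => ?_
  by_cases h1 : P p <;> by_cases h2 : Q p <;> simp [Set.indicator, h1, h2]

/-- If every walk satisfying `R` splits into a `P`-walk and a `Q`-walk, then the weights are
submultiplicative. -/
theorem pairWeight_le_of_append {φ : Sym2 V → ℝ} (hφ : ∀ e ∈ G.edgeSet, 0 < φ e)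
    {P Q R : WalkProp G} {u v : V}
    (h : ∀ p : G.Walk u v, R p → ∃ x, ∃ q : G.Walk u x, ∃ r : G.Walk x v,
      P q ∧ Q r ∧ p = q.append r) :
    pairWeight φ R u v ≤ ∑' x, pairWeight φ P u x * pairWeight φ Q x v := by
  rw [tsum_pairWeight_mul_eq]
  refine tsum_subtype_le_of_rel (f := fun p : G.Walk u v => ewt φ p)
    (g := fun b : Σ x, G.Walk u x × G.Walk x v => ewt φ b.2.1 * ewt φ b.2.2)
    (fun p b => p = b.2.1.append b.2.2) ?_ (fun _ _ _ _ _ h1 h2 => h1.trans h2.symm)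
  intro p hp
  obtain ⟨x, q, r, hq, hr, e⟩ := h p hp
  exact ⟨⟨x, q, r⟩, ⟨hq, hr⟩, e, by rw [e, ewt_append hφ]⟩

theorem outWeight_le_of_append {φ : Sym2 V → ℝ} (hφ : ∀ e ∈ G.edgeSet, 0 < φ e)
    {P Q R : WalkProp G} {u : V}
    (h : ∀ v, ∀ p : G.Walk u v, R p → ∃ x, ∃ q : G.Walk u x, ∃ r : G.Walk x v,
      P q ∧ Q r ∧ p = q.append r) :
    outWeight φ R u ≤ ∑' x, pairWeight φ P u x * outWeight φ Q x := by
  calc outWeight φ R u ≤ ∑' v, ∑' x, pairWeight φ P u x * pairWeight φ Q x v :=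
        ENNReal.tsum_le_tsum fun v => pairWeight_le_of_append hφ (h v)
    _ = _ := by
        rw [ENNReal.tsum_comm]
        simp only [ENNReal.tsum_mul_left, outWeight]

/-- A walk in a simple graph is determined by its support, and the common length of the first pieces
fixes where the support is cut. -/
theorem append_injective_of_length_eq {u x x' v : V} {q : G.Walk u x} {r : G.Walk x v}
    {q' : G.Walk u x'} {r' : G.Walk x' v} (hl : q.length = q'.length)
    (h : q.append r = q'.append r') :
    (⟨x, q, r⟩ : Σ x, G.Walk u x × G.Walk x v) = ⟨x', q', r'⟩ := by
  have hs := congrArg SimpleGraph.Walk.support h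
  rw [SimpleGraph.Walk.support_append, SimpleGraph.Walk.support_append] at hs
  obtain ⟨h1, h2⟩ := List.append_inj hs (by simp [hl])
  have hx : x = x' := by
    rw [← q.getLast_support, ← q'.getLast_support]
    simp only [h1]
  subst hx
  have hq : q = q' := SimpleGraph.Walk.ext_support h1
  have hr : r = r' := by
    apply SimpleGraph.Walk.ext_support
    rw [← r.cons_tail_support, ← r'.cons_tail_support, h2]
  rw [hq, hr]

/-- If `P`-walks of length `m` and `Q`-walks concatenate to `R`-walks, then the weights are
supermultiplicative. -/
theorem tsum_pairWeight_mul_le {φ : Sym2 V → ℝ} (hφ : ∀ e ∈ G.edgeSet, 0 < φ e)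
    {P Q R : WalkProp G} {u v : V} (m : ℕ) (hm : ∀ x, ∀ q : G.Walk u x, P q → q.length = m)
    (h : ∀ x, ∀ q : G.Walk u x, ∀ r : G.Walk x v, P q → Q r → R (q.append r)) :
    ∑' x, pairWeight φ P u x * pairWeight φ Q x v ≤ pairWeight φ R u v := by
  rw [tsum_pairWeight_mul_eq]
  refine tsum_subtype_le_of_rel (g := fun p : G.Walk u v => ewt φ p)
    (f := fun b : Σ x, G.Walk u x × G.Walk x v => ewt φ b.2.1 * ewt φ b.2.2)
    (fun b p => p = b.2.1.append b.2.2) ?_ ?_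
  · rintro ⟨x, q, r⟩ ⟨hq, hr⟩
    exact ⟨q.append r, h _ _ _ hq hr, rfl, by rw [ewt_append hφ]⟩
  · rintro ⟨x, q, r⟩ ⟨x', q', r'⟩ b hP hP' rfl h2
    exact append_injective_of_length_eq ((hm _ _ hP.1).trans (hm _ _ hP'.1).symm) h2

theorem tsum_pairWeight_mul_outWeight_le {φ : Sym2 V → ℝ} (hφ : ∀ e ∈ G.edgeSet, 0 < φ e)
    {P Q R : WalkProp G} {u : V} (m : ℕ) (hm : ∀ x, ∀ q : G.Walk u x, P q → q.length = m)
    (h : ∀ x v, ∀ q : G.Walk u x, ∀ r : G.Walk x v, P q → Q r → R (q.append r)) :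
    ∑' x, pairWeight φ P u x * outWeight φ Q x ≤ outWeight φ R u := by
  calc ∑' x, pairWeight φ P u x * outWeight φ Q x
      = ∑' v, ∑' x, pairWeight φ P u x * pairWeight φ Q x v := by
        rw [ENNReal.tsum_comm]
        simp only [ENNReal.tsum_mul_left, outWeight]
    _ ≤ _ := ENNReal.tsum_le_tsum fun v => tsum_pairWeight_mul_le hφ m hm fun x => h x v

/-- Reversing walks that end at `v` and prolonging them by an edge to a neighbour. -/
theorem mul_outWeight_le_of_reverse_cons {φ : Sym2 V → ℝ} (hφ : ∀ e ∈ G.edgeSet, 0 < φ e)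
    {c : ℝ} (hc : ∀ e ∈ G.edgeSet, c ≤ φ e) (next : V → V) (hnext : ∀ x, G.Adj (next x) x)
    {P Q : WalkProp G} {v : V}
    (h : ∀ x, ∀ p : G.Walk v x, P p → Q (SimpleGraph.Walk.cons (hnext x) p.reverse)) :
    ENNReal.ofReal c * outWeight φ P v ≤ ∑' w, pairWeight φ Q w v := by
  rw [outWeight_eq, tsum_pairWeight_left_eq, ← ENNReal.tsum_mul_left]
  refine tsum_subtype_le_of_rel (g := fun p : Σ u, G.Walk u v => ewt φ p.2)
    (f := fun p : Σ u, G.Walk v u => ENNReal.ofReal c * ewt φ p.2)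
    -- Dropping the prepended vertex leaves the reversed support, which determines the original
    -- walk.
    (fun p q => q.2.support.tail = p.2.support.reverse) ?_ ?_
  · rintro ⟨x, p⟩ hp
    refine ⟨⟨next x, SimpleGraph.Walk.cons (hnext x) p.reverse⟩, h x p hp, ?_, ?_⟩
    · simp
    · dsimp only
      rw [ewt_cons hφ, ewt_reverse]
      gcongr
      exact hc _ (hnext x)
  · rintro ⟨x, p⟩ ⟨x', p'⟩ b - - h1 h2
    have hs : p.support = p'.support := List.reverse_injective (h1.symm.trans h2)
    have hx : x = x' := by
      rw [← p.getLast_support, ← p'.getLast_support]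
      simp only [hs]
    subst hx
    rw [SimpleGraph.Walk.ext_support hs]

theorem tsum_pairWeight_fiber (φ : Sym2 V → ℝ) (P : WalkProp G)
    (g : ∀ ⦃u v : V⦄, G.Walk u v → ℕ) (u v : V) :
    ∑' n, pairWeight φ (fun _ _ p => P p ∧ g p = n) u v = pairWeight φ P u v := by
  simp only [pairWeight_eq_indicator]
  rw [ENNReal.tsum_comm]
  refine tsum_congr fun p => ?_
  rw [tsum_eq_single (g p)]
  · by_cases h : P p <;> simp [Set.indicator, h]
  · intro n hn
    simp [Set.indicator, hn.symm]

theorem tsum_outWeight_fiber (φ : Sym2 V → ℝ) (P : WalkProp G)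
    (g : ∀ ⦃u v : V⦄, G.Walk u v → ℕ) (u : V) :
    ∑' n, outWeight φ (fun _ _ p => P p ∧ g p = n) u = outWeight φ P u := by
  simp only [outWeight]
  rw [ENNReal.tsum_comm]
  exact tsum_congr fun v => tsum_pairWeight_fiber φ P g u v

theorem ewt_le_pairWeight (φ : Sym2 V → ℝ) {P : WalkProp G} {u v : V} (p : G.Walk u v)
    (hp : P p) : ewt φ p ≤ pairWeight φ P u v :=
  ENNReal.le_tsum (f := fun p : {p : G.Walk u v // P p} => ewt φ p.1) ⟨p, hp⟩

theorem ofReal_totalWeight {φ : Sym2 V → ℝ} (hφ : ∀ e ∈ G.edgeSet, 0 < φ e) {v : V}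
    (P : WalkProp G) (hf : {p : Σ w : V, G.Walk v w | P p.2}.Finite) :
    ENNReal.ofReal (totalWeight φ {p : Σ w : V, G.Walk v w | P p.2}) = outWeight φ P v := by
  have := hf.to_subtype
  rw [outWeight_eq, totalWeight, ENNReal.ofReal_tsum_of_nonneg
    (fun p => walkWeight_nonneg hφ _) (Summable.of_finite)]
  rfl

/-! ### The action of `H` on walks and vertices -/

/-- Invariance of a property of walks under a group of automorphisms. -/
def WalkProp.Invariant (P : WalkProp G) (H : Subgroup (G ≃g G)) : Prop :=
  ∀ α ∈ H, ∀ ⦃u v : V⦄ (p : G.Walk u v), P p → P (p.map (α : G →g G))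

theorem walkWeight_map {φ : Sym2 V → ℝ} {H : Subgroup (G ≃g G)}
    (hφ : IsInvariantEdgeWeight G H φ) {α : G ≃g G} (hα : α ∈ H) {u v : V} (p : G.Walk u v) :
    walkWeight φ (p.map (α : G →g G)) = walkWeight φ p := by
  induction p with
  | nil => rfl
  | cons h p ih =>
    simp only [walkWeight, SimpleGraph.Walk.map_cons, SimpleGraph.Walk.edges_cons, List.map_cons,
      List.prod_cons] at ih ⊢
    rw [ih]
    congr 1
    exact hφ.invariant α hα _ _ h

theorem pairWeight_smul {φ : Sym2 V → ℝ} {H : Subgroup (G ≃g G)}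
    (hφ : IsInvariantEdgeWeight G H φ) {P : WalkProp G} (hP : P.Invariant H) {α : G ≃g G}
    (hα : α ∈ H) (u v : V) : pairWeight φ P (α u) (α v) = pairWeight φ P u v := by
  have key : ∀ α ∈ H, ∀ u v : V, pairWeight φ P u v ≤ pairWeight φ P (α u) (α v) := by
    intro α hα u v
    refine tsum_subtype_le_of_rel (f := fun p : G.Walk u v => ewt φ p)
      (g := fun p : G.Walk (α u) (α v) => ewt φ p)
      (fun p q => q = p.map (α : G →g G)) ?_ ?_
    · intro p hp
      exact ⟨p.map (α : G →g G), hP α hα p hp, rfl, by rw [ewt, ewt, walkWeight_map hφ hα]⟩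
    · intro p p' b _ _ h1 h2
      exact SimpleGraph.Walk.map_injective_of_injective (f := (α : G →g G)) α.injective _ _
        (h1.symm.trans h2)
  refine le_antisymm ?_ (key α hα u v)
  have := key α⁻¹ (H.inv_mem hα) (α u) (α v)
  have e : ∀ x : V, α⁻¹ (α x) = x := fun x => α.symm_apply_apply x
  rwa [e, e] at this

theorem outWeight_smul {φ : Sym2 V → ℝ} {H : Subgroup (G ≃g G)}
    (hφ : IsInvariantEdgeWeight G H φ) {P : WalkProp G} (hP : P.Invariant H) {α : G ≃g G}
    (hα : α ∈ H) (u : V) : outWeight φ P (α u) = outWeight φ P u := by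
  rw [outWeight, outWeight, ← α.toEquiv.tsum_eq]
  exact tsum_congr fun v => pairWeight_smul hφ hP hα u v

theorem mem_orbit_iff_exists {H : Subgroup (G ≃g G)} {u v : V} :
    v ∈ MulAction.orbit H u ↔ ∃ α ∈ H, α u = v := by
  constructor
  · rintro ⟨⟨α, hα⟩, rfl⟩
    exact ⟨α, hα, rfl⟩
  · rintro ⟨α, hα, rfl⟩
    exact ⟨⟨α, hα⟩, rfl⟩

theorem mem_orbit_stabilizer_iff_exists {H : Subgroup (G ≃g G)} {u v w : V} :
    w ∈ MulAction.orbit (MulAction.stabilizer H u) v ↔ ∃ α ∈ H, α u = u ∧ α v = w := by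
  constructor
  · rintro ⟨⟨⟨α, hα⟩, hu⟩, rfl⟩
    exact ⟨α, hα, hu, rfl⟩
  · rintro ⟨α, hα, hu, rfl⟩
    exact ⟨⟨⟨α, hα⟩, hu⟩, rfl⟩

theorem exists_finset_representatives {H : Subgroup (G ≃g G)}
    (hH : ActsQuasiTransitively G H) :
    ∃ R : Finset V, ∀ x, ∃ r ∈ R, ∃ α ∈ H, α r = x := by
  classical
  have : Finite (MulAction.orbitRel.Quotient H V) := hH
  have := Fintype.ofFinite (MulAction.orbitRel.Quotient H V)
  refine ⟨Finset.univ.image (fun q : MulAction.orbitRel.Quotient H V => q.out), fun x => ?_⟩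
  let q : MulAction.orbitRel.Quotient H V := Quotient.mk _ x
  refine ⟨q.out, Finset.mem_image_of_mem _ (Finset.mem_univ _), ?_⟩
  have h : (MulAction.orbitRel H V) q.out x := Quotient.exact (Quotient.out_eq q)
  rw [MulAction.orbitRel_apply] at h
  obtain ⟨α, hα, e⟩ := mem_orbit_iff_exists.1 h
  refine ⟨α⁻¹, H.inv_mem hα, ?_⟩
  rw [← e]
  exact α.symm_apply_apply x

theorem finite_setOf_walk_length_le [G.LocallyFinite] (n : ℕ) (v : V) :
    {x | ∃ p : G.Walk v x, p.length ≤ n}.Finite := by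
  have : (⋃ m ∈ Set.Iic n, Sigma.fst '' {p : Σ w : V, G.Walk v w | p.2.length = m}).Finite :=
    (Set.finite_Iic n).biUnion fun m _ => (walks_finite G m v).image _
  refine this.subset ?_
  rintro x ⟨p, hp⟩
  exact Set.mem_biUnion (x := p.length) hp ⟨⟨x, p⟩, rfl, rfl⟩

theorem finite_orbit_stabilizer [G.LocallyFinite] (hG : G.Connected) (H : Subgroup (G ≃g G))
    (u v : V) : (MulAction.orbit (MulAction.stabilizer H u) v).Finite := by
  obtain ⟨p⟩ := hG.preconnected u v
  refine (finite_setOf_walk_length_le (G := G) p.length u).subset ?_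
  intro w hw
  obtain ⟨α, -, hu, rfl⟩ := mem_orbit_stabilizer_iff_exists.1 hw
  exact ⟨(p.map (α : G →g G)).copy hu rfl, by simp⟩

theorem exists_walk_to_orbit (hG : G.Connected) {H : Subgroup (G ≃g G)}
    (hH : ActsQuasiTransitively G H) :
    ∃ D : ℕ, ∀ x v : V, ∃ α ∈ H, ∃ p : G.Walk x (α v), p.length ≤ D := by
  classical
  obtain ⟨R, hR⟩ := exists_finset_representatives hH
  have hw : ∀ a b : V, Nonempty (G.Walk a b) := fun a b => hG.preconnected a b
  let w : ∀ a b : V, G.Walk a b := fun a b => (hw a b).some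
  refine ⟨(R ×ˢ R).sup fun z => (w z.1 z.2).length, fun x v => ?_⟩
  obtain ⟨r, hr, α, hα, rfl⟩ := hR x
  obtain ⟨s, hs, β, hβ, rfl⟩ := hR v
  have e : (α : G →g G) s = (α * β⁻¹) (β s) := congrArg α (β.symm_apply_apply s).symm
  have e' : (α : G →g G) r = α r := rfl
  refine ⟨α * β⁻¹, H.mul_mem hα (H.inv_mem hβ), ((w r s).map (α : G →g G)).copy e' e, ?_⟩
  rw [SimpleGraph.Walk.length_copy, SimpleGraph.Walk.length_map]
  exact Finset.le_sup (f := fun z : V × V => (w z.1 z.2).length)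
    (Finset.mem_product.2 ⟨hr, hs⟩ : (r, s) ∈ R ×ˢ R)

/-! ### Mass transport -/

/-- A function of two vertices that is invariant under the diagonal action of `H`. -/
def DiagonallyInvariant (H : Subgroup (G ≃g G)) (f : V → V → ℝ≥0∞) : Prop :=
  ∀ α ∈ H, ∀ u v, f (α u) (α v) = f u v

/-- The mass transport principle within an orbit. -/
theorem tsum_orbit_le_tsum_orbit [G.LocallyFinite] (hG : G.Connected)
    {H : Subgroup (G ≃g G)} (hH : ActsUnimodularly G H) {f : V → V → ℝ≥0∞}
    (hf : DiagonallyInvariant H f) (v : V) :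
    ∑' x : MulAction.orbit H v, f x v ≤ ∑' y : MulAction.orbit H v, f v y := by
  classical
  -- `R x y` says that some element of `H` carries the pair `(x, v)` to `(v, y)`, so `f x v = f v
  -- y`. The two sums are compared by double counting along this relation.
  let R : V → V → Prop := fun x y => ∃ α ∈ H, α x = v ∧ α v = y
  let N : V → ℝ≥0∞ := fun x => ((MulAction.orbit (MulAction.stabilizer H v) x).encard : ℝ≥0∞)
  have hleft : ∀ α : G ≃g G, ∀ z, α⁻¹ (α z) = z := fun α z => α.symm_apply_apply z
  have hright : ∀ α : G ≃g G, ∀ z, α (α⁻¹ z) = z := fun α z => α.apply_symm_apply z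
  have hN0 : ∀ x, N x ≠ 0 := by
    intro x h
    have h' : (MulAction.orbit (MulAction.stabilizer H v) x).encard = 0 := by
      simpa [N] using h
    rw [Set.encard_eq_zero] at h'
    exact (MulAction.nonempty_orbit x).ne_empty h'
  have hNtop : ∀ x, N x ≠ ⊤ := by
    intro x h
    have h' : (MulAction.orbit (MulAction.stabilizer H v) x).encard = ⊤ := by
      simpa [N] using h
    exact (finite_orbit_stabilizer hG H v x).encard_lt_top.ne h'
  have hcount : ∀ s : Set V, ∑' z, s.indicator (fun _ => (1 : ℝ≥0∞)) z = (s.encard : ℝ≥0∞) := by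
    intro s
    rw [← tsum_subtype, ENNReal.tsum_set_one]
  -- Unimodularity enters here: the row of `x` is a translate of the orbit of `v` under the
  -- stabilizer of `x`, which has as many points as the orbit of `x` under the stabilizer of `v`.
  have hrow : ∀ x ∈ MulAction.orbit H v, (({y | R x y}.encard : ℕ∞) : ℝ≥0∞) = N x := by
    intro x hx
    obtain ⟨β, hβ, hβx⟩ := mem_orbit_iff_exists.1 hx
    have e : {y | R x y} = (β⁻¹ : G ≃g G) '' (MulAction.orbit (MulAction.stabilizer H x) v) := by
      ext y
      constructor
      · rintro ⟨α, hα, h1, rfl⟩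
        refine ⟨β (α v), mem_orbit_stabilizer_iff_exists.2 ⟨β * α, H.mul_mem hβ hα, ?_, rfl⟩,
          hleft _ _⟩
        change β (α x) = x
        rw [h1, hβx]
      · rintro ⟨z, hz, rfl⟩
        obtain ⟨α, hα, h1, rfl⟩ := mem_orbit_stabilizer_iff_exists.1 hz
        refine ⟨β⁻¹ * α, H.mul_mem (H.inv_mem hβ) hα, ?_, rfl⟩
        change β⁻¹ (α x) = v
        rw [h1, ← hβx, hleft]
    have h2 := hH v x hx
    simp only [N]
    rw [e, (β⁻¹ : G ≃g G).injective.encard_image, h2]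
  have hcol : ∀ x y, R x y → {x' | R x' y} = MulAction.orbit (MulAction.stabilizer H v) x := by
    rintro x y ⟨α, hα, h1, h2⟩
    ext x'
    rw [mem_orbit_stabilizer_iff_exists]
    constructor
    · rintro ⟨β, hβ, h3, h4⟩
      refine ⟨β⁻¹ * α, H.mul_mem (H.inv_mem hβ) hα, ?_, ?_⟩
      · change β⁻¹ (α v) = v
        rw [h2, ← h4, hleft]
      · change β⁻¹ (α x) = x'
        rw [h1, ← h3, hleft]
    · rintro ⟨β, hβ, h3, rfl⟩
      refine ⟨α * β⁻¹, H.mul_mem hα (H.inv_mem hβ), ?_, ?_⟩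
      · change α (β⁻¹ (β x)) = v
        rw [hleft, h1]
      · change α (β⁻¹ v) = y
        rw [← h2]
        congr 1
        conv_lhs => rw [← h3]
        exact hleft _ _
  have hRl : ∀ x y, R x y → x ∈ MulAction.orbit H v := by
    rintro x y ⟨α, hα, h1, h2⟩
    exact mem_orbit_iff_exists.2 ⟨α⁻¹, H.inv_mem hα, by rw [← h1, hleft]⟩
  have hRr : ∀ x y, R x y → y ∈ MulAction.orbit H v := by
    rintro x y ⟨α, hα, h1, h2⟩
    exact mem_orbit_iff_exists.2 ⟨α, hα, h2⟩
  have hRf : ∀ x y, R x y → f x v = f v y := by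
    rintro x y ⟨α, hα, h1, h2⟩
    rw [← hf α hα x v, h1, h2]
  -- Each `f x v` is shared equally over the `N x` members of its row. A nonempty column is one
  -- stabilizer orbit, on which `N` is constant and equal to the size of the column, so it sums back
  -- to `f v y`.
  let F : V → V → ℝ≥0∞ := fun x y => if R x y then f v y * (N x)⁻¹ else 0
  have hL : ∀ x ∈ MulAction.orbit H v, f x v = ∑' y, F x y := by
    intro x hx
    have : ∀ y, F x y = f x v * (N x)⁻¹ * {y | R x y}.indicator (fun _ => (1 : ℝ≥0∞)) y := by
      intro y
      by_cases h : R x y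
      · simp [F, h, hRf x y h]
      · simp [F, h]
    simp only [this]
    rw [ENNReal.tsum_mul_left, hcount, hrow x hx, mul_assoc,
      ENNReal.inv_mul_cancel (hN0 x) (hNtop x), mul_one]
  have hRt : ∀ y, ∑' x, F x y ≤ (MulAction.orbit H v).indicator (fun y => f v y) y := by
    intro y
    by_cases hy : ∃ x, R x y
    · obtain ⟨x₀, h₀⟩ := hy
      have : ∀ x, F x y =
          f v y * (N x₀)⁻¹ * {x | R x y}.indicator (fun _ => (1 : ℝ≥0∞)) x := by
        intro x
        by_cases h : R x y
        · have : N x = N x₀ := by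
            simp only [N]
            rw [← hcol x y h, ← hcol x₀ y h₀]
          simp [F, h, this]
        · simp [F, h]
      simp only [this]
      rw [ENNReal.tsum_mul_left, hcount, hcol x₀ y h₀, mul_assoc,
        ENNReal.inv_mul_cancel (hN0 x₀) (hNtop x₀), mul_one,
        Set.indicator_of_mem (hRr _ _ h₀)]
    · push Not at hy
      simp [F, hy]
  calc ∑' x : MulAction.orbit H v, f x v = ∑' x : MulAction.orbit H v, ∑' y, F x y :=
        tsum_congr fun x => hL x x.2
    _ ≤ ∑' x, ∑' y, F x y :=
        ENNReal.tsum_comp_le_tsum_of_injective Subtype.val_injective (fun x => ∑' y, F x y)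
    _ = ∑' y, ∑' x, F x y := ENNReal.tsum_comm
    _ ≤ ∑' y, (MulAction.orbit H v).indicator (fun y => f v y) y := ENNReal.tsum_le_tsum hRt
    _ = _ := (tsum_subtype _ _).symm

/-- The mass transport principle, as an inequality up to a constant. -/
theorem exists_tsum_le_mul_iSup_tsum [G.LocallyFinite] (hG : G.Connected)
    {H : Subgroup (G ≃g G)} (hqt : ActsQuasiTransitively G H) (hH : ActsUnimodularly G H) (v : V) :
    ∃ C : ℝ≥0∞, C ≠ ⊤ ∧ ∀ f : V → V → ℝ≥0∞, DiagonallyInvariant H f →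
      ∑' x, f x v ≤ C * ⨆ u, ∑' y, f u y := by
  classical
  obtain ⟨D, hD⟩ := exists_walk_to_orbit hG hqt
  let B : Set V := {x | ∃ p : G.Walk v x, p.length ≤ D}
  have hB : B.Finite := finite_setOf_walk_length_le D v
  let near : V → V → Prop := fun a b => ∃ p : G.Walk a b, p.length ≤ D
  have near_map : ∀ α : G ≃g G, ∀ a b, near a b → near (α a) (α b) := by
    rintro α a b ⟨p, hp⟩
    exact ⟨p.map (α : G →g G), by simpa using hp⟩
  refine ⟨(B.encard : ℝ≥0∞), ?_, fun f hf => ?_⟩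
  · have := hB.encard_lt_top.ne
    simpa using this
  -- Every vertex is within `D` of the orbit of `v`. Moving the mass of `x` to all vertices near it
  -- therefore reduces to transport within that orbit, at the cost of the size of a ball.
  let g : V → V → ℝ≥0∞ := fun a b => ∑' x, if near a x then f x b else 0
  have hg : DiagonallyInvariant H g := by
    intro α hα a b
    simp only [g]
    rw [← α.toEquiv.tsum_eq]
    refine tsum_congr fun x => ?_
    change (if near (α a) (α x) then f (α x) (α b) else 0) = _
    have : near (α a) (α x) ↔ near a x := by
      refine ⟨fun h => ?_, near_map α a x⟩
      have := near_map α⁻¹ _ _ h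
      have e : ∀ z, α⁻¹ (α z) = z := fun z => α.symm_apply_apply z
      rwa [e, e] at this
    simp only [this, hf α hα x b]
  have h1 : ∑' x, f x v ≤ ∑' a : MulAction.orbit H v, g a v := by
    simp only [g]
    rw [ENNReal.tsum_comm]
    refine ENNReal.tsum_le_tsum fun x => ?_
    obtain ⟨α, hα, p, hp⟩ := hD x v
    have hn : near (α v) x := ⟨p.reverse, by simpa using hp⟩
    calc f x v = if near (α v) x then f x v else 0 := by rw [if_pos hn]
      _ ≤ _ := ENNReal.le_tsum
        (f := fun a : MulAction.orbit H v => if near (a : V) x then f x v else 0)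
        ⟨α v, mem_orbit_iff_exists.2 ⟨α, hα, rfl⟩⟩
  refine h1.trans ((tsum_orbit_le_tsum_orbit hG hH hg v).trans ?_)
  calc ∑' y : MulAction.orbit H v, g v y ≤ ∑' y, g v y :=
        ENNReal.tsum_comp_le_tsum_of_injective Subtype.val_injective (fun y => g v y)
    _ = ∑' x, ∑' y, if near v x then f x y else 0 := ENNReal.tsum_comm
    _ ≤ ∑' x, B.indicator (fun _ => (1 : ℝ≥0∞)) x * ⨆ u, ∑' y, f u y := by
        refine ENNReal.tsum_le_tsum fun x => ?_
        by_cases hx : near v x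
        · have : x ∈ B := hx
          simp only [hx, if_true, Set.indicator_of_mem this, one_mul]
          exact le_iSup (fun u => ∑' y, f u y) x
        · simp [hx]
    _ = _ := by
        rw [ENNReal.tsum_mul_right, ← tsum_subtype, ENNReal.tsum_set_one]

/-! ### Uniform bounds from quasi-transitivity -/

/-- Up to `H` there are finitely many starting vertices, each with finitely many neighbours. -/
theorem exists_bound_of_invariant [G.LocallyFinite] {H : Subgroup (G ≃g G)}
    (hqt : ActsQuasiTransitively G H) (F : V → V → ℝ)
    (hF : ∀ α ∈ H, ∀ u v : V, G.Adj u v → F (α u) (α v) = F u v) :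
    ∃ M, ∀ u v, G.Adj u v → F u v ≤ M := by
  obtain ⟨R, hR⟩ := exists_finset_representatives hqt
  have hfin : (⋃ r ∈ (R : Set V), Set.range fun x : G.neighborSet r => F r x).Finite :=
    R.finite_toSet.biUnion fun r _ => Set.finite_range _
  obtain ⟨M, hM⟩ := hfin.bddAbove
  refine ⟨M, fun u v huv => ?_⟩
  obtain ⟨r, hr, α, hα, rfl⟩ := hR u
  have hv : α (α⁻¹ v) = v := α.apply_symm_apply v
  have hadj : G.Adj r (α⁻¹ v) := by
    rw [← hv] at huv
    exact α.map_adj_iff.1 huv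
  rw [← hv, hF α hα _ _ hadj]
  exact hM (Set.mem_biUnion hr ⟨⟨_, hadj⟩, rfl⟩)

theorem exists_weight_lower_bound [G.LocallyFinite] {H : Subgroup (G ≃g G)}
    (hqt : ActsQuasiTransitively G H) {φ : Sym2 V → ℝ} (hφ : IsInvariantEdgeWeight G H φ) :
    ∃ c : ℝ, 0 < c ∧ c ≤ 1 ∧ ∀ e ∈ G.edgeSet, c ≤ φ e := by
  obtain ⟨M, hM⟩ := exists_bound_of_invariant hqt (fun u v => (φ s(u, v))⁻¹)
    (fun α hα u v h => by rw [hφ.invariant α hα u v h])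
  have hM1 : 0 < max M 1 := lt_max_of_lt_right one_pos
  refine ⟨(max M 1)⁻¹, inv_pos.2 hM1, inv_le_one_of_one_le₀ (le_max_right _ _), fun e => ?_⟩
  induction e with
  | _ u v =>
    intro he
    exact inv_le_of_inv_le₀ (hφ.pos _ he) ((hM u v he).trans (le_max_left _ _))

theorem outWeight_le_sum_representatives {φ : Sym2 V → ℝ} {H : Subgroup (G ≃g G)}
    (hφ : IsInvariantEdgeWeight G H φ) {R : Finset V}
    (hR : ∀ x, ∃ r ∈ R, ∃ α ∈ H, α r = x) {P : WalkProp G} (hP : P.Invariant H) (u : V) :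
    outWeight φ P u ≤ ∑ r ∈ R, outWeight φ P r := by
  obtain ⟨r, hr, α, hα, rfl⟩ := hR u
  rw [outWeight_smul hφ hP hα]
  exact Finset.single_le_sum (f := fun r => outWeight φ P r) (fun _ _ => zero_le) hr

theorem ofReal_pow_le_ewt {φ : Sym2 V → ℝ} (hφ : ∀ e ∈ G.edgeSet, 0 < φ e) {c : ℝ}
    (hc : ∀ e ∈ G.edgeSet, c ≤ φ e) {u v : V} (p : G.Walk u v) :
    ENNReal.ofReal c ^ p.length ≤ ewt φ p := by
  induction p with
  | nil => simp [ewt, walkWeight]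
  | cons h p ih =>
    rw [ewt_cons hφ, Walk.length_cons, pow_succ']
    gcongr
    exact hc _ h

/-- Walks with `n` steps. -/
def HasLength (n : ℕ) : WalkProp G := fun _ _ p => p.length = n

theorem HasLength.invariant (H : Subgroup (G ≃g G)) (n : ℕ) :
    (HasLength n : WalkProp G).Invariant H := fun α _ _ _ p hp =>
  (Walk.length_map (α : G →g G) p).trans hp

theorem outWeight_hasLength_zero_le (φ : Sym2 V → ℝ) (v : V) :
    outWeight φ (HasLength 0 : WalkProp G) v ≤ 1 := by
  rw [outWeight_eq]
  refine (tsum_subtype_le_of_rel (f := fun p : Σ w, G.Walk v w => ewt φ p.2)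
    (Q := fun _ : Unit => True) (g := fun _ => 1) (fun _ _ => True) ?_ ?_).trans ?_
  · rintro ⟨w, p⟩ hp
    cases p with
    | nil => exact ⟨(), trivial, trivial, by simp [ewt, walkWeight]⟩
    | cons h p => simp [HasLength] at hp
  · rintro ⟨w, p⟩ ⟨w', p'⟩ - hp hp' - -
    cases p with
    | nil =>
      cases p' with
      | nil => rfl
      | cons h p => simp [HasLength] at hp'
    | cons h p => simp [HasLength] at hp
  · rw [tsum_fintype]
    simp

theorem exists_outWeight_hasLength_le [G.LocallyFinite] {H : Subgroup (G ≃g G)}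
    (hqt : ActsQuasiTransitively G H) {φ : Sym2 V → ℝ} (hφ : IsInvariantEdgeWeight G H φ) :
    ∃ K : ℝ≥0∞, K ≠ ⊤ ∧ ∀ n v, outWeight φ (HasLength n : WalkProp G) v ≤ K ^ n := by
  obtain ⟨R, hR⟩ := exists_finset_representatives hqt
  refine ⟨∑ r ∈ R, outWeight φ (HasLength 1 : WalkProp G) r, ?_, fun n => ?_⟩
  · refine ENNReal.sum_ne_top.2 fun r _ => ?_
    rw [← ofReal_totalWeight hφ.pos (HasLength 1) (walks_finite G 1 r)]
    exact ENNReal.ofReal_ne_top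
  · induction n with
    | zero => simpa using outWeight_hasLength_zero_le (G := G) φ
    | succ n ih =>
      intro v
      calc outWeight φ (HasLength (n + 1) : WalkProp G) v
          ≤ ∑' x, pairWeight φ (HasLength 1 : WalkProp G) v x *
              outWeight φ (HasLength n : WalkProp G) x := by
            refine outWeight_le_of_append hφ.pos fun w p hp => ?_
            cases p with
            | nil => simp [HasLength] at hp
            | cons h p =>
              exact ⟨_, Walk.cons h Walk.nil, p, rfl, by simpa [HasLength] using hp, rfl⟩
        _ ≤ ∑' x, pairWeight φ (HasLength 1 : WalkProp G) v x *
              (∑ r ∈ R, outWeight φ (HasLength 1 : WalkProp G) r) ^ n := by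
            gcongr with x
            exact ih x
        _ = outWeight φ (HasLength 1 : WalkProp G) v *
              (∑ r ∈ R, outWeight φ (HasLength 1 : WalkProp G) r) ^ n := by
            rw [ENNReal.tsum_mul_right, outWeight]
        _ ≤ _ := by
            rw [pow_succ']
            gcongr
            exact outWeight_le_sum_representatives hφ hR (HasLength.invariant H 1) v

/-! ### Bridges: concatenation and comparison between vertices -/

/-- Self-avoiding bridges. -/
def PathBridge (h : V → ℤ) : WalkProp G := fun _ _ p => p.IsPath ∧ IsBridge h p

/-- Self-avoiding bridges with `n` steps. -/
def BridgeOfLength (h : V → ℤ) (n : ℕ) : WalkProp G := fun _ _ p =>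
  (p.IsPath ∧ p.length = n) ∧ IsBridge h p

theorem height_le_of_isBridge {h : V → ℤ} {u v : V} {p : G.Walk u v} (hp : IsBridge h p) :
    h u ≤ h v := by
  cases p with
  | nil => exact le_rfl
  | cons e p =>
    have := hp v (by simp)
    exact this.1.le.trans this.2

/-- The first bridge stays at or below the height of `x` and the second, after its start, strictly
above it, so they cannot meet again. -/
theorem PathBridge.append {h : V → ℤ} {u x v : V} {p : G.Walk u x} {q : G.Walk x v}
    (hp : PathBridge h p) (hq : PathBridge h q) : PathBridge h (p.append q) := by
  have hx : ∀ y ∈ p.support, h y ≤ h x := by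
    intro y hy
    rw [← p.cons_tail_support, List.mem_cons] at hy
    rcases hy with rfl | hy
    · exact height_le_of_isBridge hp.2
    · exact (hp.2 y hy).2
  constructor
  · rw [SimpleGraph.Walk.isPath_def, Walk.support_append, List.nodup_append]
    refine ⟨(Walk.isPath_def _).1 hp.1, ((Walk.isPath_def _).1 hq.1).tail, ?_⟩
    rintro a ha b hb rfl
    exact absurd (hx a ha) (not_le.2 (hq.2 a hb).1)
  · intro y hy
    rw [Walk.tail_support_append, List.mem_append] at hy
    rcases hy with hy | hy
    · exact ⟨(hp.2 y hy).1, (hp.2 y hy).2.trans (height_le_of_isBridge hq.2)⟩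
    · exact ⟨(height_le_of_isBridge hp.2).trans_lt (hq.2 y hy).1, (hq.2 y hy).2⟩

theorem BridgeOfLength.append {h : V → ℤ} {m n : ℕ} {u x v : V} {p : G.Walk u x}
    {q : G.Walk x v} (hp : BridgeOfLength h m p) (hq : BridgeOfLength h n q) :
    BridgeOfLength h (m + n) (p.append q) := by
  have := PathBridge.append ⟨hp.1.1, hp.2⟩ ⟨hq.1.1, hq.2⟩
  exact ⟨⟨this.1, by rw [Walk.length_append, hp.1.2, hq.1.2]⟩, this.2⟩

theorem bridgeOfLength_nil (h : V → ℤ) (u : V) :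
    BridgeOfLength h 0 (Walk.nil : G.Walk u u) :=
  ⟨⟨Walk.IsPath.nil, rfl⟩, by simp [IsBridge]⟩

theorem bridgeOfLength_one {h : V → ℤ} {u v : V} (e : G.Adj u v) (huv : h u < h v) :
    BridgeOfLength h 1 (Walk.cons e Walk.nil) := by
  refine ⟨⟨by simp [e.ne], rfl⟩, ?_⟩
  simp [IsBridge, huv]

theorem exists_bridgeOfLength_from {h : V → ℤ} (hup : ∀ v, ∃ w, G.Adj v w ∧ h v < h w) (n : ℕ)
    (u : V) : ∃ x, ∃ p : G.Walk u x, BridgeOfLength h n p ∧ h u + n ≤ h x := by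
  induction n generalizing u with
  | zero => exact ⟨u, Walk.nil, bridgeOfLength_nil h u, by simp⟩
  | succ n ih =>
    obtain ⟨w, e, hw⟩ := hup u
    obtain ⟨x, p, hp, hx⟩ := ih w
    refine ⟨x, _, add_comm n 1 ▸ (bridgeOfLength_one e hw).append hp, ?_⟩
    push_cast
    omega

theorem exists_bridgeOfLength_to {h : V → ℤ} (hdown : ∀ v, ∃ w, G.Adj v w ∧ h w < h v) (n : ℕ)
    (v : V) : ∃ x, ∃ p : G.Walk x v, BridgeOfLength h n p ∧ h x + n ≤ h v := by
  induction n generalizing v with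
  | zero => exact ⟨v, Walk.nil, bridgeOfLength_nil h v, by simp⟩
  | succ n ih =>
    obtain ⟨w, e, hw⟩ := hdown v
    obtain ⟨x, p, hp, hx⟩ := ih w
    refine ⟨x, _, hp.append (bridgeOfLength_one e.symm hw), ?_⟩
    push_cast
    omega

theorem isBridge_map {h : V → ℤ} {H : Subgroup (G ≃g G)}
    (hh : ∀ α ∈ H, ∀ u v : V, h (α v) - h (α u) = h v - h u) {α : G ≃g G} (hα : α ∈ H)
    {u v : V} {p : G.Walk u v} (hp : IsBridge h p) : IsBridge h (p.map (α : G →g G)) := by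
  intro x hx
  rw [Walk.support_map, ← List.map_tail, List.mem_map] at hx
  obtain ⟨y, hy, rfl⟩ := hx
  have h1 := hh α hα u y
  have h2 := hh α hα y v
  have h3 := hp y hy
  change h (α u) < h (α y) ∧ h (α y) ≤ h (α v)
  omega

theorem isPath_map (α : G ≃g G) {u v : V} {p : G.Walk u v} (hp : p.IsPath) :
    (p.map (α : G →g G)).IsPath :=
  hp.map (f := (α : G →g G)) α.injective

theorem PathBridge.invariant {h : V → ℤ} {H : Subgroup (G ≃g G)}
    (hh : ∀ α ∈ H, ∀ u v : V, h (α v) - h (α u) = h v - h u) :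
    (PathBridge h : WalkProp G).Invariant H := fun α hα _ _ _ hp =>
  ⟨isPath_map α hp.1, isBridge_map hh hα hp.2⟩

theorem BridgeOfLength.invariant {h : V → ℤ} {H : Subgroup (G ≃g G)}
    (hh : ∀ α ∈ H, ∀ u v : V, h (α v) - h (α u) = h v - h u) (n : ℕ) :
    (BridgeOfLength h n : WalkProp G).Invariant H := fun α hα _ _ p hp =>
  ⟨⟨isPath_map α hp.1.1, (Walk.length_map (α : G →g G) p).trans hp.1.2⟩, isBridge_map hh hα hp.2⟩

theorem exists_height_lipschitz [G.LocallyFinite] {H : Subgroup (G ≃g G)}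
    (hqt : ActsQuasiTransitively G H) {h : V → ℤ}
    (hh : ∀ α ∈ H, ∀ u v : V, h (α v) - h (α u) = h v - h u) :
    ∃ d : ℕ, ∀ u v : V, ∀ p : G.Walk u v, ∀ x ∈ p.support, |h x - h u| ≤ d * p.length := by
  obtain ⟨M, hM⟩ := exists_bound_of_invariant hqt (fun u v => ((|h v - h u| : ℤ) : ℝ))
    (fun α hα u v _ => by rw [hh α hα u v])
  have hd : ∀ u v, G.Adj u v → |h v - h u| ≤ (⌈M⌉₊ : ℤ) := by
    intro u v huv
    have := (hM u v huv).trans (Nat.le_ceil M)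
    exact_mod_cast this
  refine ⟨⌈M⌉₊, fun u v p => ?_⟩
  induction p with
  | nil => simp
  | @cons u w v e p ih =>
    intro x hx
    rw [Walk.support_cons, List.mem_cons] at hx
    rcases hx with rfl | hx
    · rw [sub_self, abs_zero]
      positivity
    · have h1 := ih x hx
      have h2 := hd u w e
      have h3 := abs_sub_le (h x) (h w) (h u)
      rw [Walk.length_cons]
      push_cast
      linarith

theorem abs_height_sub_end_le {h : V → ℤ} {d : ℕ}
    (hd : ∀ u v : V, ∀ p : G.Walk u v, ∀ x ∈ p.support, |h x - h u| ≤ d * p.length) {u v : V}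
    (p : G.Walk u v) {x : V} (hx : x ∈ p.support) : |h x - h v| ≤ d * p.length := by
  have := hd v u p.reverse x (by simpa using hx)
  simpa using this

/-- Any vertex is joined to any orbit by a bridge of bounded length. -/
theorem exists_pathBridge_to_orbit [G.LocallyFinite] (hG : G.Connected) {root : V} {h : V → ℤ}
    {H : Subgroup (G ≃g G)} (hH : IsGraphHeightFunction G root h H) :
    ∃ r : ℕ, ∀ u v : V, ∃ α ∈ H, ∃ p : G.Walk u (α v), PathBridge h p ∧ p.length ≤ r := by
  classical
  obtain ⟨D, hD⟩ := exists_walk_to_orbit hG hH.quasiTransitive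
  obtain ⟨d, hd⟩ := exists_height_lipschitz hH.quasiTransitive hH.differenceInvariant
  have hup : ∀ v, ∃ w, G.Adj v w ∧ h v < h w := fun v => by
    obtain ⟨_, w, _, h1, _, h2⟩ := hH.exists_lower_upper v
    exact ⟨w, h1, h2⟩
  have hdown : ∀ v, ∃ w, G.Adj v w ∧ h w < h v := fun v => by
    obtain ⟨w, _, h1, _, h2, _⟩ := hH.exists_lower_upper v
    exact ⟨w, h1, h2⟩
  -- A connecting walk of at most `D` steps changes height by at most `d * D`. Climbing `k` before
  -- and after it keeps it strictly between the heights of the two ends.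
  let k := d * D + 1
  refine ⟨k + D + k, fun u v => ?_⟩
  obtain ⟨a, p, hp, ha⟩ := exists_bridgeOfLength_from hup k u
  obtain ⟨b, q, hq, hb⟩ := exists_bridgeOfLength_to hdown k v
  obtain ⟨α, hα, m, hm⟩ := hD a b
  have hq' : BridgeOfLength h k (q.map (α : G →g G)) :=
    BridgeOfLength.invariant hH.differenceInvariant k α hα q hq
  let q' : G.Walk (α b) (α v) := q.map (α : G →g G)
  have hq'' : BridgeOfLength h k q' := hq'
  have hb' : h (α b) + k ≤ h (α v) := by
    have := hH.differenceInvariant α hα b v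
    omega
  have hk : ((k : ℕ) : ℤ) = d * D + 1 := by simp [k]
  have hdm : (d : ℤ) * m.length ≤ d * D := by gcongr
  have hmid1 : ∀ x ∈ m.support, h u < h x := by
    intro x hx
    have := abs_le.1 (hd _ _ m x hx)
    linarith
  have hmid2 : ∀ x ∈ m.support, h x < h (α v) := by
    intro x hx
    have := abs_le.1 (abs_height_sub_end_le hd m hx)
    linarith
  -- This walk obeys the height constraints of a bridge but may revisit vertices, including `u`.
  -- Loop erasure only shrinks the support and leaves `u` just at the start.
  let w := (p.append m).append q'
  have hw : ∀ x ∈ w.support, x = u ∨ (h u < h x ∧ h x ≤ h (α v)) := by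
    intro x hx
    rw [Walk.mem_support_append_iff, Walk.mem_support_append_iff] at hx
    rcases hx with (hx | hx) | hx
    · rw [← p.cons_tail_support, List.mem_cons] at hx
      rcases hx with rfl | hx
      · exact Or.inl rfl
      · have h1 := hp.2 x hx
        have h2 := hmid2 a m.start_mem_support
        exact Or.inr ⟨h1.1, h1.2.trans h2.le⟩
    · exact Or.inr ⟨hmid1 x hx, (hmid2 x hx).le⟩
    · have h0 := hmid1 _ m.end_mem_support
      rw [← q'.cons_tail_support, List.mem_cons] at hx
      rcases hx with rfl | hx
      · exact Or.inr ⟨h0, (hmid2 _ m.end_mem_support).le⟩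
      · have h1 := hq''.2 x hx
        exact Or.inr ⟨h0.trans h1.1, h1.2⟩
  refine ⟨α, hα, w.bypass, ⟨w.bypass_isPath, fun x hx => ?_⟩, ?_⟩
  · have hne : x ≠ u := by
      rintro rfl
      have := w.bypass_isPath.support_nodup
      rw [← w.bypass.cons_tail_support, List.nodup_cons] at this
      exact this.1 hx
    exact (hw x (w.support_bypass_subset_support (List.mem_of_mem_tail hx))).resolve_left hne
  · refine w.length_bypass_le_length.trans ?_
    have h1 : w.length = p.length + m.length + q'.length := by
      simp only [w, Walk.length_append]
    rw [h1, hp.1.2, hq''.1.2]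
    omega

theorem tsum_pairWeight_mul_outWeight_bridgeOfLength_le {φ : Sym2 V → ℝ}
    (hφ : ∀ e ∈ G.edgeSet, 0 < φ e) (h : V → ℤ) (m n : ℕ) (u : V) :
    ∑' x, pairWeight φ (BridgeOfLength h m : WalkProp G) u x *
        outWeight φ (BridgeOfLength h n : WalkProp G) x ≤
      outWeight φ (BridgeOfLength h (m + n) : WalkProp G) u :=
  tsum_pairWeight_mul_outWeight_le hφ m (fun _ _ hq => hq.1.2) fun _ _ _ _ hq hr => hq.append hr

theorem ofReal_pow_le_outWeight_bridgeOfLength {φ : Sym2 V → ℝ}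
    (hφ : ∀ e ∈ G.edgeSet, 0 < φ e) {c : ℝ} (hc : ∀ e ∈ G.edgeSet, c ≤ φ e) {h : V → ℤ}
    (hup : ∀ v, ∃ w, G.Adj v w ∧ h v < h w) (n : ℕ) (u : V) :
    ENNReal.ofReal c ^ n ≤ outWeight φ (BridgeOfLength h n : WalkProp G) u := by
  obtain ⟨x, p, hp, -⟩ := exists_bridgeOfLength_from hup n u
  calc ENNReal.ofReal c ^ n = ENNReal.ofReal c ^ p.length := by rw [hp.1.2]
    _ ≤ ewt φ p := ofReal_pow_le_ewt hφ hc p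
    _ ≤ pairWeight φ (BridgeOfLength h n) u x := ewt_le_pairWeight φ p hp
    _ ≤ _ := ENNReal.le_tsum x

/-- The weights of bridges from different vertices are comparable, up to a bounded change of
length. -/
theorem exists_mul_outWeight_bridgeOfLength_le [G.LocallyFinite] (hG : G.Connected) {root : V}
    {h : V → ℤ} {H : Subgroup (G ≃g G)} (hH : IsGraphHeightFunction G root h H)
    {φ : Sym2 V → ℝ} (hφ : IsInvariantEdgeWeight G H φ) :
    ∃ r : ℕ, ∃ c : ℝ≥0∞, c ≠ 0 ∧ ∀ n u v,
      c * outWeight φ (BridgeOfLength h n : WalkProp G) v ≤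
        outWeight φ (BridgeOfLength h (n + r) : WalkProp G) u := by
  obtain ⟨r, hr⟩ := exists_pathBridge_to_orbit hG hH
  obtain ⟨c, hc0, -, hc⟩ := exists_weight_lower_bound hH.quasiTransitive hφ
  have hup : ∀ v, ∃ w, G.Adj v w ∧ h v < h w := fun v => by
    obtain ⟨_, w, _, h1, _, h2⟩ := hH.exists_lower_upper v
    exact ⟨w, h1, h2⟩
  refine ⟨r, ENNReal.ofReal c ^ r, pow_ne_zero _ (by simpa using hc0), fun n u v => ?_⟩
  obtain ⟨α, hα, p, hp, hl⟩ := hr u v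
  have h1 : ENNReal.ofReal c ^ p.length * outWeight φ (BridgeOfLength h n : WalkProp G) v ≤
      outWeight φ (BridgeOfLength h (p.length + n) : WalkProp G) u := by
    rw [← outWeight_smul hφ (BridgeOfLength.invariant hH.differenceInvariant n) hα v]
    refine le_trans ?_ (tsum_pairWeight_mul_outWeight_bridgeOfLength_le hφ.pos h p.length n u)
    refine le_trans ?_ (ENNReal.le_tsum (α v))
    gcongr
    exact (ofReal_pow_le_ewt hφ.pos hc p).trans
      (ewt_le_pairWeight φ (P := BridgeOfLength h p.length) p ⟨⟨hp.1, rfl⟩, hp.2⟩)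
  -- The connecting bridge has variable length at most `r`; padding at the far end by further bridge
  -- steps makes the total exactly `n + r`.
  have h2 : outWeight φ (BridgeOfLength h (p.length + n) : WalkProp G) u *
      ENNReal.ofReal c ^ (r - p.length) ≤
      outWeight φ (BridgeOfLength h (p.length + n + (r - p.length)) : WalkProp G) u := by
    refine le_trans ?_
      (tsum_pairWeight_mul_outWeight_bridgeOfLength_le hφ.pos h _ (r - p.length) u)
    rw [outWeight, ← ENNReal.tsum_mul_right]
    gcongr with x
    exact ofReal_pow_le_outWeight_bridgeOfLength hφ.pos hc hup _ x
  have e1 : p.length + n + (r - p.length) = n + r := by omega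
  have e2 : ENNReal.ofReal c ^ r =
      ENNReal.ofReal c ^ p.length * ENNReal.ofReal c ^ (r - p.length) := by
    rw [← pow_add]
    congr 1
    omega
  rw [e1] at h2
  refine le_trans ?_ h2
  rw [e2, mul_right_comm]
  gcongr

/-! ### Half-space walks and the Hammersley–Welsh decomposition -/

/-- Split a walk at its last visit to a set. -/
theorem exists_eq_append_last (S : V → Prop) {u v : V} (p : G.Walk u v)
    (hS : ∃ x ∈ p.support, S x) : ∃ x, ∃ q : G.Walk u x, ∃ r : G.Walk x v,
      p = q.append r ∧ S x ∧ ∀ y ∈ r.support.tail, ¬ S y := by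
  induction p with
  | @nil u =>
    obtain ⟨x, hx, hSx⟩ := hS
    rw [Walk.mem_support_nil_iff] at hx
    subst hx
    exact ⟨x, Walk.nil, Walk.nil, rfl, hSx, by simp⟩
  | @cons u w v e p ih =>
    by_cases h : ∃ x ∈ p.support, S x
    · obtain ⟨x, q, r, hp, hx, hr⟩ := ih h
      exact ⟨x, Walk.cons e q, r, by rw [hp, Walk.cons_append], hx, hr⟩
    · obtain ⟨x, hx, hSx⟩ := hS
      rw [Walk.support_cons, List.mem_cons] at hx
      rcases hx with rfl | hx
      · refine ⟨x, Walk.nil, Walk.cons e p, rfl, hSx, fun y hy hSy => h ⟨y, ?_, hSy⟩⟩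
        simpa using hy
      · exact absurd ⟨x, hx, hSx⟩ h

/-- Self-avoiding half-space walks that stay at height at most `T` above their start. -/
def HalfSpace (h : V → ℤ) (T : ℕ) : WalkProp G := fun u _ p =>
  p.IsPath ∧ (∀ x ∈ p.support.tail, h u < h x) ∧ ∀ x ∈ p.support, h x ≤ h u + T

/-- Self-avoiding bridges whose endpoints have height difference `T`. -/
def BridgeOfSpan (h : V → ℤ) (T : ℕ) : WalkProp G := fun u v p =>
  PathBridge h p ∧ (h v - h u).toNat = T

theorem HalfSpace.invariant {h : V → ℤ} {H : Subgroup (G ≃g G)}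
    (hh : ∀ α ∈ H, ∀ u v : V, h (α v) - h (α u) = h v - h u) (T : ℕ) :
    (HalfSpace h T : WalkProp G).Invariant H := by
  intro α hα u v p hp
  refine ⟨isPath_map α hp.1, fun x hx => ?_, fun x hx => ?_⟩
  · rw [Walk.support_map, ← List.map_tail, List.mem_map] at hx
    obtain ⟨y, hy, rfl⟩ := hx
    have h1 := hh α hα u y
    have h3 := hp.2.1 y hy
    change h (α u) < h (α y)
    omega
  · rw [Walk.support_map, List.mem_map] at hx
    obtain ⟨y, hy, rfl⟩ := hx
    have h1 := hh α hα u y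
    have h3 := hp.2.2 y hy
    change h (α y) ≤ h (α u) + T
    omega

theorem BridgeOfSpan.invariant {h : V → ℤ} {H : Subgroup (G ≃g G)}
    (hh : ∀ α ∈ H, ∀ u v : V, h (α v) - h (α u) = h v - h u) (T : ℕ) :
    (BridgeOfSpan h T : WalkProp G).Invariant H := by
  intro α hα u v p hp
  refine ⟨PathBridge.invariant hh α hα p hp.1, ?_⟩
  change (h (α v) - h (α u)).toNat = T
  rw [hh α hα u v]
  exact hp.2

/-- A half-space walk of span `T + 1` splits at its last highest vertex into a bridge and a
half-space walk of smaller span in the opposite direction. -/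
theorem HalfSpace.succ_cases {h : V → ℤ} {T : ℕ} {u v : V} {p : G.Walk u v}
    (hp : HalfSpace h (T + 1) p) : HalfSpace h T p ∨ ∃ x, ∃ q : G.Walk u x, ∃ r : G.Walk x v,
      BridgeOfSpan h (T + 1) q ∧ HalfSpace (-h) T r ∧ p = q.append r := by
  by_cases hT : ∃ x ∈ p.support, h x = h u + T + 1
  · right
    obtain ⟨x, q, r, rfl, hx, hr⟩ := exists_eq_append_last (fun x => h x = h u + T + 1) p hT
    obtain ⟨hpath, hlow, hhigh⟩ := hp
    refine ⟨x, q, r, ⟨⟨hpath.of_append_left, fun y hy => ?_⟩, ?_⟩, ⟨hpath.of_append_right, ?_, ?_⟩,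
      rfl⟩
    · have h1 := hlow y (by rw [Walk.tail_support_append]; exact List.mem_append_left _ hy)
      have h2 := hhigh y (by
        rw [Walk.mem_support_append_iff]; exact Or.inl (List.mem_of_mem_tail hy))
      push_cast at h2
      omega
    · omega
    · intro y hy
      have h1 := hr y hy
      have h2 := hhigh y (by
        rw [Walk.mem_support_append_iff]; exact Or.inr (List.mem_of_mem_tail hy))
      push_cast at h2
      simp only [Pi.neg_apply]
      omega
    -- The remainder starts at height `h u + T + 1` and stays strictly above `h u`, so it descends
    -- at most `T`.
    · intro y hy
      simp only [Pi.neg_apply]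
      rw [← r.cons_tail_support, List.mem_cons] at hy
      rcases hy with rfl | hy
      · omega
      · have h1 := hlow y (by rw [Walk.tail_support_append]; exact List.mem_append_right _ hy)
        omega
  · left
    push Not at hT
    refine ⟨hp.1, hp.2.1, fun x hx => ?_⟩
    have h1 := hp.2.2 x hx
    have h2 := hT x hx
    push_cast at h1
    omega

/-- One step of the recursion on the span. Suprema over vertices are needed since the remainder
starts at an arbitrary vertex. -/
theorem iSup_outWeight_halfSpace_succ_le {φ : Sym2 V → ℝ} (hφ : ∀ e ∈ G.edgeSet, 0 < φ e)
    (h : V → ℤ) (T : ℕ) :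
    ⨆ v, outWeight φ (HalfSpace h (T + 1) : WalkProp G) v ≤
      (⨆ v, outWeight φ (HalfSpace h T : WalkProp G) v) +
        (⨆ v, outWeight φ (BridgeOfSpan h (T + 1) : WalkProp G) v) *
          ⨆ v, outWeight φ (HalfSpace (-h) T : WalkProp G) v := by
  refine iSup_le fun v => ?_
  let S : WalkProp G := fun u v p => ∃ x, ∃ q : G.Walk u x, ∃ r : G.Walk x v,
      BridgeOfSpan h (T + 1) q ∧ HalfSpace (-h) T r ∧ p = q.append r
  have hS : outWeight φ S v ≤ (⨆ v, outWeight φ (BridgeOfSpan h (T + 1) : WalkProp G) v) *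
      ⨆ v, outWeight φ (HalfSpace (-h) T : WalkProp G) v := by
    calc outWeight φ S v ≤ ∑' x, pairWeight φ (BridgeOfSpan h (T + 1) : WalkProp G) v x *
          outWeight φ (HalfSpace (-h) T : WalkProp G) x :=
          outWeight_le_of_append hφ fun _ _ hp => hp
      _ ≤ ∑' x, pairWeight φ (BridgeOfSpan h (T + 1) : WalkProp G) v x *
          ⨆ v, outWeight φ (HalfSpace (-h) T : WalkProp G) v := by
          gcongr with x
          exact le_iSup (fun v => outWeight φ (HalfSpace (-h) T : WalkProp G) v) x
      _ ≤ _ := by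
          rw [ENNReal.tsum_mul_right]
          gcongr
          exact le_iSup (fun v => outWeight φ (BridgeOfSpan h (T + 1) : WalkProp G) v) v
  calc outWeight φ (HalfSpace h (T + 1) : WalkProp G) v
      ≤ outWeight φ (fun _ _ p => HalfSpace h T p ∨ S p) v :=
        outWeight_mono φ fun w p hp => hp.succ_cases
    _ ≤ outWeight φ (HalfSpace h T : WalkProp G) v + outWeight φ S v := by
        simp only [outWeight]
        rw [← ENNReal.tsum_add]
        exact ENNReal.tsum_le_tsum fun w => pairWeight_or_le φ _ _ v w
    _ ≤ _ := add_le_add (le_iSup (fun v => outWeight φ (HalfSpace h T : WalkProp G) v) v) hS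

theorem iSup_outWeight_halfSpace_zero_le (φ : Sym2 V → ℝ) (h : V → ℤ) :
    ⨆ v, outWeight φ (HalfSpace h 0 : WalkProp G) v ≤ 1 := by
  refine iSup_le fun v => (outWeight_mono φ fun w p hp => ?_).trans
    (outWeight_hasLength_zero_le φ v)
  cases p with
  | nil => rfl
  | @cons _ x _ e p =>
    have h1 := hp.2.1 x (by simp)
    have h2 := hp.2.2 x (by simp)
    push_cast at h2
    omega

/-- From `1 + x ≤ exp x`. -/
theorem exists_prod_one_add_le {s : ℕ → ℝ≥0∞} (hs : ∑' t, s t ≠ ⊤) :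
    ∃ K : ℝ≥0∞, K ≠ ⊤ ∧ ∀ T, ∏ t ∈ Finset.range T, (1 + s t) ≤ K := by
  have hfin : ∀ t, s t ≠ ⊤ := ENNReal.ne_top_of_tsum_ne_top hs
  refine ⟨ENNReal.ofReal (Real.exp (∑' t, s t).toReal), ENNReal.ofReal_ne_top, fun T => ?_⟩
  calc ∏ t ∈ Finset.range T, (1 + s t)
      ≤ ∏ t ∈ Finset.range T, ENNReal.ofReal (Real.exp (s t).toReal) := by
        refine Finset.prod_le_prod' fun t _ => ?_
        have : 1 + s t = ENNReal.ofReal (1 + (s t).toReal) := by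
          rw [ENNReal.ofReal_add zero_le_one ENNReal.toReal_nonneg, ENNReal.ofReal_one,
            ENNReal.ofReal_toReal (hfin t)]
        rw [this]
        refine ENNReal.ofReal_le_ofReal ?_
        rw [add_comm]
        exact Real.add_one_le_exp _
    _ = ENNReal.ofReal (Real.exp (∑ t ∈ Finset.range T, s t).toReal) := by
        rw [← ENNReal.ofReal_prod_of_nonneg fun _ _ => (Real.exp_pos _).le, ← Real.exp_sum,
          ENNReal.toReal_sum fun t _ => hfin t]
    _ ≤ _ := by
        refine ENNReal.ofReal_le_ofReal (Real.exp_le_exp.2 ?_)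
        exact ENNReal.toReal_mono hs (ENNReal.sum_le_tsum _)

/-- The supremum for each span is at most the sum over orbit representatives; for each
representative, summing over spans recovers all its bridges. -/
theorem tsum_iSup_outWeight_bridgeOfSpan_le {φ : Sym2 V → ℝ} {H : Subgroup (G ≃g G)}
    (hφ : IsInvariantEdgeWeight G H φ) {R : Finset V}
    (hR : ∀ x, ∃ r ∈ R, ∃ α ∈ H, α r = x) {h : V → ℤ}
    (hh : ∀ α ∈ H, ∀ u v : V, h (α v) - h (α u) = h v - h u) :
    ∑' T, ⨆ v, outWeight φ (BridgeOfSpan h T : WalkProp G) v ≤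
      ∑ r ∈ R, outWeight φ (PathBridge h : WalkProp G) r := by
  calc ∑' T, ⨆ v, outWeight φ (BridgeOfSpan h T : WalkProp G) v
      ≤ ∑' T, ∑ r ∈ R, outWeight φ (BridgeOfSpan h T : WalkProp G) r :=
        ENNReal.tsum_le_tsum fun T => iSup_le fun v =>
          outWeight_le_sum_representatives hφ hR (BridgeOfSpan.invariant hh T) v
    _ = ∑ r ∈ R, ∑' T, outWeight φ (BridgeOfSpan h T : WalkProp G) r :=
        Summable.tsum_finsetSum fun _ _ => ENNReal.summable
    _ = _ := Finset.sum_congr rfl fun r _ =>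
        tsum_outWeight_fiber φ (PathBridge h) (fun u v _ => (h v - h u).toNat) r

/-- If bridges and downward bridges have finite total weights, then half-space walks have uniformly
bounded total weights. -/
theorem exists_outWeight_halfSpace_le {φ : Sym2 V → ℝ} {H : Subgroup (G ≃g G)}
    (hφ : IsInvariantEdgeWeight G H φ) (hqt : ActsQuasiTransitively G H) {h : V → ℤ}
    (hh : ∀ α ∈ H, ∀ u v : V, h (α v) - h (α u) = h v - h u)
    (hup : ∀ v, outWeight φ (PathBridge h : WalkProp G) v ≠ ⊤)
    (hdown : ∀ v, outWeight φ (PathBridge (-h) : WalkProp G) v ≠ ⊤) :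
    ∃ K : ℝ≥0∞, K ≠ ⊤ ∧ ∀ T v, outWeight φ (HalfSpace h T : WalkProp G) v ≤ K := by
  obtain ⟨R, hR⟩ := exists_finset_representatives hqt
  have hh' : ∀ α ∈ H, ∀ u v : V, (-h) (α v) - (-h) (α u) = (-h) v - (-h) u := by
    intro α hα u v
    have := hh α hα u v
    simp only [Pi.neg_apply]
    omega
  let b : (V → ℤ) → ℕ → ℝ≥0∞ := fun h T => ⨆ v, outWeight φ (BridgeOfSpan h T : WalkProp G) v
  let M : (V → ℤ) → ℕ → ℝ≥0∞ := fun h T => ⨆ v, outWeight φ (HalfSpace h T : WalkProp G) v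
  -- Both directions are included because the recursion swaps `h` and `-h`: the two bounds are
  -- proved by a joint induction. Span `0` never occurs as a factor.
  let s : ℕ → ℝ≥0∞ := fun T => b h (T + 1) + b (-h) (T + 1)
  have hb : ∀ h : V → ℤ, (∀ α ∈ H, ∀ u v : V, h (α v) - h (α u) = h v - h u) →
      (∀ v, outWeight φ (PathBridge h : WalkProp G) v ≠ ⊤) → ∑' T, b h (T + 1) ≠ ⊤ := by
    intro h hh hfin
    refine ne_top_of_le_ne_top ?_ ((ENNReal.tsum_comp_le_tsum_of_injective
      (add_left_injective 1) (b h)).trans (tsum_iSup_outWeight_bridgeOfSpan_le hφ hR hh))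
    exact ENNReal.sum_ne_top.2 fun r _ => hfin r
  have hs : ∑' T, s T ≠ ⊤ := by
    simp only [s]
    rw [ENNReal.tsum_add]
    exact ENNReal.add_ne_top.2 ⟨hb h hh hup, hb (-h) hh' hdown⟩
  obtain ⟨K, hK, hKT⟩ := exists_prod_one_add_le hs
  have hrec : ∀ T, M h T ≤ ∏ t ∈ Finset.range T, (1 + s t) ∧
      M (-h) T ≤ ∏ t ∈ Finset.range T, (1 + s t) := by
    intro T
    induction T with
    | zero =>
      rw [Finset.range_zero, Finset.prod_empty]
      exact ⟨iSup_outWeight_halfSpace_zero_le φ h, iSup_outWeight_halfSpace_zero_le φ (-h)⟩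
    | succ T ih =>
      have h1 := iSup_outWeight_halfSpace_succ_le hφ.pos h T
      have h2 := iSup_outWeight_halfSpace_succ_le hφ.pos (-h) T
      rw [neg_neg] at h2
      rw [Finset.prod_range_succ, mul_add, mul_one]
      constructor
      · refine h1.trans (add_le_add ih.1 ?_)
        rw [mul_comm]
        exact mul_le_mul' ih.2 le_self_add
      · refine h2.trans (add_le_add ih.2 ?_)
        rw [mul_comm]
        exact mul_le_mul' ih.1 le_add_self
  exact ⟨K, hK, fun T v =>
    (le_iSup (fun v => outWeight φ (HalfSpace h T : WalkProp G) v) v).trans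
      ((hrec T).1.trans (hKT T))⟩

/-! ### From bridges to all self-avoiding walks -/

/-- Mass transport: reversal and prolongation by one edge turns walks from `v` into walks to `v`,
whose weight is controlled by the weights of walks from a vertex. -/
theorem exists_outWeight_le_of_reverse_cons [G.LocallyFinite] (hG : G.Connected)
    {H : Subgroup (G ≃g G)} (hqt : ActsQuasiTransitively G H) (hH : ActsUnimodularly G H)
    {φ : Sym2 V → ℝ} (hφ : IsInvariantEdgeWeight G H φ) (next : V → V)
    (hnext : ∀ x, G.Adj (next x) x) (v : V) :
    ∃ C : ℝ≥0∞, C ≠ ⊤ ∧ ∀ P Q : WalkProp G, Q.Invariant H →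
      (∀ x, ∀ p : G.Walk v x, P p → Q (Walk.cons (hnext x) p.reverse)) →
      outWeight φ P v ≤ C * ⨆ u, outWeight φ Q u := by
  obtain ⟨c, hc0, -, hc⟩ := exists_weight_lower_bound hqt hφ
  obtain ⟨C, hC, hmtp⟩ := exists_tsum_le_mul_iSup_tsum hG hqt hH v
  have hc' : ENNReal.ofReal c ≠ 0 := by simpa using hc0
  -- The constant is fixed before `P` and `Q`, so it can serve a family of walk classes that varies
  -- with `n`.
  refine ⟨(ENNReal.ofReal c)⁻¹ * C, ENNReal.mul_ne_top (ENNReal.inv_ne_top.2 hc') hC,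
    fun P Q hQ hPQ => ?_⟩
  have h1 := mul_outWeight_le_of_reverse_cons hφ.pos hc next hnext hPQ
  have h2 := hmtp (fun u w => pairWeight φ Q u w) fun α hα u w => pairWeight_smul hφ hQ hα u w
  calc outWeight φ P v
      = (ENNReal.ofReal c)⁻¹ * (ENNReal.ofReal c * outWeight φ P v) := by
        rw [← mul_assoc, ENNReal.inv_mul_cancel hc' ENNReal.ofReal_ne_top, one_mul]
    _ ≤ (ENNReal.ofReal c)⁻¹ * (C * ⨆ u, outWeight φ Q u) := by
        exact mul_le_mul_right (h1.trans h2) _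
    _ = _ := (mul_assoc _ _ _).symm

/-- Self-avoiding walks with `n` steps. -/
def SawOfLength (n : ℕ) : WalkProp G := fun _ _ p => p.IsPath ∧ p.length = n

/-- If the bridges from a vertex have bounded total weight, then so do the `n`-step self-avoiding
walks, uniformly in `n`. -/
theorem exists_outWeight_sawOfLength_le [G.LocallyFinite] (hG : G.Connected) {root : V}
    {h : V → ℤ} {H : Subgroup (G ≃g G)} (hH : IsUnimodularGraphHeightFunction G root h H)
    {φ : Sym2 V → ℝ} (hφ : IsInvariantEdgeWeight G H φ) {B : ℝ≥0∞} (hB : B ≠ ⊤)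
    (hbridge : ∀ v, outWeight φ (PathBridge h : WalkProp G) v ≤ B) (v : V) :
    ∃ M : ℝ≥0∞, M ≠ ⊤ ∧ ∀ n, outWeight φ (SawOfLength n : WalkProp G) v ≤ M := by
  classical
  have hh := hH.differenceInvariant
  have hqt := hH.quasiTransitive
  choose next hadj hlt using fun v => (hH.exists_lower_upper v).imp fun u hu =>
    (⟨hu.choose_spec.1.symm, hu.choose_spec.2.2.1⟩ : G.Adj u v ∧ h u < h v)
  -- A reversed downward bridge starts at a lowest vertex, possibly tied with later ones. Prepending
  -- a strictly lower neighbour removes the tie and yields an upward bridge that ends at `v`.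
  have hdown : ∀ v, outWeight φ (PathBridge (-h) : WalkProp G) v ≠ ⊤ := by
    intro v
    obtain ⟨C, hC, hCv⟩ := exists_outWeight_le_of_reverse_cons hG hqt hH.unimodular hφ next hadj v
    refine ne_top_of_le_ne_top (ENNReal.mul_ne_top hC hB)
      ((hCv (PathBridge (-h)) (PathBridge h) (PathBridge.invariant hh) ?_).trans
        (mul_le_mul_right (iSup_le hbridge) C))
    intro x p hp
    have hx : ∀ y ∈ p.support, h x ≤ h y ∧ h y ≤ h v := by
      intro y hy
      rw [← p.cons_tail_support, List.mem_cons] at hy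
      rcases hy with rfl | hy
      · have := height_le_of_isBridge hp.2
        simp only [Pi.neg_apply] at this
        omega
      · have := hp.2 y hy
        simp only [Pi.neg_apply] at this
        omega
    refine ⟨?_, fun y hy => ?_⟩
    · rw [SimpleGraph.Walk.cons_isPath_iff]
      refine ⟨hp.1.reverse, fun hm => ?_⟩
      have := (hx (next x) (by simpa using hm)).1
      exact absurd (hlt x) (not_lt.2 this)
    · have := hx y (by simpa using hy)
      exact ⟨(hlt x).trans_le this.1, this.2⟩
  obtain ⟨K, hK, hKT⟩ := exists_outWeight_halfSpace_le hφ hqt hh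
    (fun v => ne_top_of_le_ne_top hB (hbridge v)) hdown
  obtain ⟨d, hd⟩ := exists_height_lipschitz hqt hh
  obtain ⟨C, hC, hCv⟩ := exists_outWeight_le_of_reverse_cons hG hqt hH.unimodular hφ next hadj v
  refine ⟨C * K * K, ENNReal.mul_ne_top (ENNReal.mul_ne_top hC hK) hK, fun n => ?_⟩
  -- The extra step accounts for the edge prepended to the reversed piece.
  let T := d * (n + 1)
  let P : WalkProp G := fun _ x p =>
    p.IsPath ∧ (∀ y ∈ p.support, h x ≤ h y) ∧ p.length ≤ n
  have hT : ∀ {u w : V} (p : G.Walk u w), p.length ≤ n + 1 → ∀ x ∈ p.support, h x ≤ h u + T := by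
    intro u w p hp x hx
    have h1 := (abs_le.1 (hd u w p x hx)).2
    have h2 : ((d * p.length : ℕ) : ℤ) ≤ (T : ℕ) := by
      exact_mod_cast Nat.mul_le_mul_left d hp
    push_cast at h2
    linarith
  have hP : outWeight φ P v ≤ C * K := by
    refine (hCv P (HalfSpace h T) (HalfSpace.invariant hh T) ?_).trans
      (mul_le_mul_right (iSup_le fun u => hKT T u) C)
    intro x p hp
    refine ⟨?_, fun y hy => ?_, hT _ ?_⟩
    · rw [SimpleGraph.Walk.cons_isPath_iff]
      refine ⟨hp.1.reverse, fun hm => ?_⟩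
      have := hp.2.1 (next x) (by simpa using hm)
      exact absurd (hlt x) (not_lt.2 this)
    · exact (hlt x).trans_le (hp.2.1 y (by simpa using hy))
    · simpa using hp.2.2
  calc outWeight φ (SawOfLength n : WalkProp G) v
      ≤ ∑' x, pairWeight φ P v x * outWeight φ (HalfSpace h T : WalkProp G) x := by
        refine outWeight_le_of_append hφ.pos fun w p hp => ?_
        -- Cutting at the last vertex of minimal height makes the second piece stay strictly above
        -- its start, and the first piece ends at its minimum.
        obtain ⟨z, hz, hzmin⟩ := p.support.toFinset.exists_min_image h
          ⟨v, by simp⟩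
        obtain ⟨x, q, r, rfl, hx, hr⟩ := exists_eq_append_last (fun x => h x = h z) p
          ⟨z, by simpa using hz, rfl⟩
        have hmin : ∀ y ∈ (q.append r).support, h x ≤ h y := fun y hy => by
          rw [hx]
          exact hzmin y (by simpa using hy)
        have hlen := hp.2
        rw [Walk.length_append] at hlen
        refine ⟨x, q, r, ⟨hp.1.of_append_left, fun y hy => hmin y ?_, by omega⟩,
          ⟨hp.1.of_append_right, fun y hy => ?_, hT r (by omega)⟩, rfl⟩
        · rw [Walk.mem_support_append_iff]
          exact Or.inl hy
        · refine lt_of_le_of_ne (hmin y ?_) fun e => hr y hy (e.symm.trans hx)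
          rw [Walk.mem_support_append_iff]
          exact Or.inr (List.mem_of_mem_tail hy)
    _ ≤ ∑' x, pairWeight φ P v x * K := by
        gcongr with x
        exact hKT T x
    _ = outWeight φ P v * K := by rw [ENNReal.tsum_mul_right, outWeight]
    _ ≤ _ := by gcongr

/-! ### Limits of roots -/

/-- Fekete's lemma for positive supermultiplicative sequences of at most exponential growth. -/
theorem exists_tendsto_root_of_supermultiplicative {B : ℕ → ℝ} (hpos : ∀ n, 0 < B n)
    (hmul : ∀ m n, B m * B n ≤ B (m + n)) {K : ℝ} (hK : ∀ n, B n ≤ K ^ n) :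
    ∃ β : ℝ, 0 < β ∧ Tendsto (fun n : ℕ => B n ^ (1 / (n : ℝ))) atTop (𝓝 β) ∧
      ∀ n, B n ≤ β ^ n := by
  have hK0 : 0 < K := by simpa using (hpos 1).trans_le (hK 1)
  have hsub : Subadditive fun n => -Real.log (B n) := by
    intro m n
    have := Real.log_le_log (mul_pos (hpos m) (hpos n)) (hmul m n)
    rw [Real.log_mul (hpos m).ne' (hpos n).ne'] at this
    linarith
  have hbdd : BddBelow (Set.range fun n : ℕ => -Real.log (B n) / n) := by
    -- The `0` covers the term `n = 0`, where division by zero gives `0`.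
    refine ⟨min 0 (-Real.log K), ?_⟩
    rintro _ ⟨n, rfl⟩
    rcases Nat.eq_zero_or_pos n with rfl | hn
    · simp
    · have hn' : (0 : ℝ) < n := by exact_mod_cast hn
      refine (min_le_right _ _).trans ?_
      dsimp only
      rw [le_div_iff₀ hn']
      have := Real.log_le_log (hpos n) (hK n)
      rw [Real.log_pow] at this
      linarith
  refine ⟨Real.exp (-hsub.lim), Real.exp_pos _, ?_, fun n => ?_⟩
  · have h1 := (Real.continuous_exp.tendsto _).comp (hsub.tendsto_lim hbdd).neg
    refine h1.congr fun n => ?_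
    rw [Function.comp_apply, Real.rpow_def_of_pos (hpos n)]
    congr 1
    ring
  · rcases Nat.eq_zero_or_pos n with rfl | hn
    · simpa using hK 0
    · have hn' : (0 : ℝ) < n := by exact_mod_cast hn
      have h1 := hsub.lim_le_div hbdd hn.ne'
      rw [le_div_iff₀ hn'] at h1
      rw [← Real.exp_nat_mul, ← Real.log_le_iff_le_exp (hpos n)]
      linarith

/-- For the upper bound, any `y > β` with `z = y⁻¹` gives `a n ≤ M * y ^ n`, and the root of `M`
tends to `1`. -/
theorem tendsto_root_of_le {a B : ℕ → ℝ} {β : ℝ} (hβ : 0 < β) (hpos : ∀ n, 0 < B n)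
    (hle : ∀ n, B n ≤ a n) (hB : Tendsto (fun n : ℕ => B n ^ (1 / (n : ℝ))) atTop (𝓝 β))
    (hbound : ∀ z, 0 < z → z * β < 1 → ∃ M, ∀ n, z ^ n * a n ≤ M) :
    Tendsto (fun n : ℕ => a n ^ (1 / (n : ℝ))) atTop (𝓝 β) := by
  rw [tendsto_order]
  constructor
  · intro x hx
    filter_upwards [(tendsto_order.1 hB).1 x hx] with n hn
    exact hn.trans_le (Real.rpow_le_rpow (hpos n).le (hle n) (by positivity))
  · intro x hx
    obtain ⟨y, hβy, hyx⟩ := exists_between hx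
    have hy : 0 < y := hβ.trans hβy
    obtain ⟨M, hM⟩ := hbound y⁻¹ (inv_pos.2 hy) (by rw [inv_mul_lt_one₀ hy]; exact hβy)
    have hM0 : 0 < M := lt_of_lt_of_le
      (mul_pos (pow_pos (inv_pos.2 hy) 0) ((hpos 0).trans_le (hle 0))) (hM 0)
    have hlim : Tendsto (fun n : ℕ => M ^ (1 / (n : ℝ)) * y) atTop (𝓝 y) := by
      have h1 := ((Real.continuous_const_rpow hM0.ne').tendsto 0).comp
        tendsto_one_div_atTop_nhds_zero_nat
      have h2 := h1.mul_const y
      simpa [Function.comp_def] using h2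
    filter_upwards [(tendsto_order.1 hlim).2 x hyx, eventually_gt_atTop 0] with n hn hn0
    refine lt_of_le_of_lt ?_ hn
    have ha : a n ≤ M * y ^ n := by
      have := hM n
      rw [inv_pow, inv_mul_le_iff₀ (pow_pos hy n)] at this
      linarith
    calc a n ^ (1 / (n : ℝ)) ≤ (M * y ^ n) ^ (1 / (n : ℝ)) :=
          Real.rpow_le_rpow ((hpos n).le.trans (hle n)) ha (by positivity)
      _ = M ^ (1 / (n : ℝ)) * y := by
          rw [Real.mul_rpow hM0.le (pow_nonneg hy.le n), one_div,
            Real.pow_rpow_inv_natCast hy.le hn0.ne']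

/-! ### Back to real weights -/

theorem totalWeight_nonneg {φ : Sym2 V → ℝ} (hφ : ∀ e ∈ G.edgeSet, 0 < φ e) {v : V}
    (S : Set (Σ w : V, G.Walk v w)) : 0 ≤ totalWeight φ S :=
  tsum_nonneg fun _ => walkWeight_nonneg hφ _

theorem ofReal_totalWeight_bridges [G.LocallyFinite] {φ : Sym2 V → ℝ}
    (hφ : ∀ e ∈ G.edgeSet, 0 < φ e) (h : V → ℤ) (n : ℕ) (v : V) :
    ENNReal.ofReal (totalWeight φ (bridges G h n v)) =
      outWeight φ (BridgeOfLength h n : WalkProp G) v :=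
  ofReal_totalWeight hφ (BridgeOfLength h n) (bridges_finite G h n v)

theorem ofReal_totalWeight_saws [G.LocallyFinite] {φ : Sym2 V → ℝ}
    (hφ : ∀ e ∈ G.edgeSet, 0 < φ e) (n : ℕ) (v : V) :
    ENNReal.ofReal (totalWeight φ (saws G n v)) = outWeight φ (SawOfLength n : WalkProp G) v :=
  ofReal_totalWeight hφ (SawOfLength n) (saws_finite G n v)

theorem bridgeWeight_le_totalWeight {φ : Sym2 V → ℝ} (hφ : ∀ e ∈ G.edgeSet, 0 < φ e)
    (h : V → ℤ) (n : ℕ) (v : V) : bridgeWeight G φ h n ≤ totalWeight φ (bridges G h n v) :=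
  ciInf_le ⟨0, by rintro _ ⟨u, rfl⟩; exact totalWeight_nonneg hφ _⟩ v

theorem bridgeWeight_nonneg {φ : Sym2 V → ℝ} (hφ : ∀ e ∈ G.edgeSet, 0 < φ e) (h : V → ℤ)
    (n : ℕ) : 0 ≤ bridgeWeight G φ h n :=
  Real.iInf_nonneg fun _ => totalWeight_nonneg hφ _

theorem le_ofReal_bridgeWeight [Nonempty V] [G.LocallyFinite] {φ : Sym2 V → ℝ}
    (hφ : ∀ e ∈ G.edgeSet, 0 < φ e) {h : V → ℤ} {n : ℕ} {t : ℝ≥0∞}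
    (ht : ∀ v, t ≤ outWeight φ (BridgeOfLength h n : WalkProp G) v) :
    t ≤ ENNReal.ofReal (bridgeWeight G φ h n) := by
  have htop : t ≠ ⊤ := by
    refine ne_top_of_le_ne_top ?_ (ht (Classical.arbitrary V))
    rw [← ofReal_totalWeight_bridges hφ]
    exact ENNReal.ofReal_ne_top
  rw [← ENNReal.ofReal_toReal htop]
  refine ENNReal.ofReal_le_ofReal (le_ciInf fun v => ?_)
  refine ENNReal.toReal_le_of_le_ofReal (totalWeight_nonneg hφ _) ?_
  rw [ofReal_totalWeight_bridges hφ]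
  exact ht v

theorem ofReal_bridgeWeight_le [G.LocallyFinite] {φ : Sym2 V → ℝ}
    (hφ : ∀ e ∈ G.edgeSet, 0 < φ e) (h : V → ℤ) (n : ℕ) (v : V) :
    ENNReal.ofReal (bridgeWeight G φ h n) ≤ outWeight φ (BridgeOfLength h n : WalkProp G) v := by
  rw [← ofReal_totalWeight_bridges hφ]
  exact ENNReal.ofReal_le_ofReal (bridgeWeight_le_totalWeight hφ h n v)

theorem bridgeWeight_mul_le [Nonempty V] [G.LocallyFinite] {φ : Sym2 V → ℝ}
    (hφ : ∀ e ∈ G.edgeSet, 0 < φ e) (h : V → ℤ) (m n : ℕ) :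
    bridgeWeight G φ h m * bridgeWeight G φ h n ≤ bridgeWeight G φ h (m + n) := by
  rw [← ENNReal.ofReal_le_ofReal_iff (bridgeWeight_nonneg hφ h _),
    ENNReal.ofReal_mul (bridgeWeight_nonneg hφ h m)]
  refine le_ofReal_bridgeWeight hφ fun v => ?_
  refine le_trans ?_ (tsum_pairWeight_mul_outWeight_bridgeOfLength_le hφ h m n v)
  calc ENNReal.ofReal (bridgeWeight G φ h m) * ENNReal.ofReal (bridgeWeight G φ h n)
      ≤ outWeight φ (BridgeOfLength h m : WalkProp G) v *
          ENNReal.ofReal (bridgeWeight G φ h n) := by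
        gcongr
        exact ofReal_bridgeWeight_le hφ h m v
    _ = ∑' x, pairWeight φ (BridgeOfLength h m : WalkProp G) v x *
          ENNReal.ofReal (bridgeWeight G φ h n) := by
        rw [ENNReal.tsum_mul_right, outWeight]
    _ ≤ _ := by
        gcongr with x
        exact ofReal_bridgeWeight_le hφ h n x

theorem bridgeWeight_pos [Nonempty V] [G.LocallyFinite] {root : V} {h : V → ℤ}
    {H : Subgroup (G ≃g G)} (hH : IsGraphHeightFunction G root h H) {φ : Sym2 V → ℝ}
    (hφ : IsInvariantEdgeWeight G H φ) (n : ℕ) : 0 < bridgeWeight G φ h n := by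
  obtain ⟨c, hc0, -, hc⟩ := exists_weight_lower_bound hH.quasiTransitive hφ
  have hup : ∀ v, ∃ w, G.Adj v w ∧ h v < h w := fun v => by
    obtain ⟨_, w, _, h1, _, h2⟩ := hH.exists_lower_upper v
    exact ⟨w, h1, h2⟩
  have h1 := le_ofReal_bridgeWeight hφ.pos fun v =>
    ofReal_pow_le_outWeight_bridgeOfLength hφ.pos hc hup n v
  have h2 : ENNReal.ofReal c ^ n ≠ 0 := pow_ne_zero _ (by simpa using hc0)
  exact ENNReal.ofReal_pos.1 ((pos_iff_ne_zero.2 h2).trans_le h1)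

theorem bridgeWeight_le_sawWeight [G.LocallyFinite] {φ : Sym2 V → ℝ}
    (hφ : ∀ e ∈ G.edgeSet, 0 < φ e) (root : V) (h : V → ℤ) (n : ℕ) :
    bridgeWeight G φ h n ≤ sawWeight G φ root n := by
  refine (bridgeWeight_le_totalWeight hφ h n root).trans ?_
  rw [sawWeight, ← ENNReal.ofReal_le_ofReal_iff (totalWeight_nonneg hφ _),
    ofReal_totalWeight_bridges hφ, ofReal_totalWeight_saws hφ]
  exact outWeight_mono φ fun _ _ hp => hp.1

theorem exists_sawWeight_le_pow [G.LocallyFinite] {H : Subgroup (G ≃g G)}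
    (hqt : ActsQuasiTransitively G H) {φ : Sym2 V → ℝ} (hφ : IsInvariantEdgeWeight G H φ)
    (root : V) : ∃ K : ℝ, ∀ n, sawWeight G φ root n ≤ K ^ n := by
  obtain ⟨K, hK, hKn⟩ := exists_outWeight_hasLength_le hqt hφ
  refine ⟨K.toReal, fun n => ?_⟩
  rw [sawWeight, ← ENNReal.ofReal_le_ofReal_iff (by positivity), ofReal_totalWeight_saws hφ.pos,
    ENNReal.ofReal_pow ENNReal.toReal_nonneg, ENNReal.ofReal_toReal hK]
  exact (outWeight_mono φ fun _ _ hp => hp.2).trans (hKn n root)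

/-- The subcritical case: geometric decay of the minimal bridge weights makes the bridges from every
vertex summable, with a common bound. -/
theorem exists_sawWeight_le_of_bridgeWeight_le [G.LocallyFinite] (hG : G.Connected) {root : V}
    {h : V → ℤ} {H : Subgroup (G ≃g G)} (hH : IsUnimodularGraphHeightFunction G root h H)
    {φ : Sym2 V → ℝ} (hφ : IsInvariantEdgeWeight G H φ) {ρ : ℝ} (hρ : ρ < 1)
    (hb : ∀ n, bridgeWeight G φ h n ≤ ρ ^ n) : ∃ M, ∀ n, sawWeight G φ root n ≤ M := by
  have : Nonempty V := ⟨root⟩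
  have hρ0 : 0 ≤ ρ := by
    simpa using (bridgeWeight_nonneg hφ.pos h 1).trans (hb 1)
  obtain ⟨r, c, hc, hcb⟩ := exists_mul_outWeight_bridgeOfLength_le hG hH.toIsGraphHeightFunction hφ
  let q := ENNReal.ofReal ρ
  have hq : q < 1 := by
    rw [← ENNReal.ofReal_one]
    exact (ENNReal.ofReal_lt_ofReal_iff one_pos).2 hρ
  -- Bridges of length `n` from `v` are compared with bridges of length `n + r` from every `u`,
  -- hence with the minimum over `u`.
  have hlen : ∀ n v, outWeight φ (BridgeOfLength h n : WalkProp G) v ≤ q ^ (n + r) / c := by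
    intro n v
    rw [ENNReal.le_div_iff_mul_le (Or.inl hc) (Or.inr (by finiteness)), mul_comm]
    refine (le_ofReal_bridgeWeight hφ.pos fun u => hcb n u v).trans ?_
    rw [← ENNReal.ofReal_pow hρ0]
    exact ENNReal.ofReal_le_ofReal (hb _)
  have hbridge : ∀ v, outWeight φ (PathBridge h : WalkProp G) v ≤
      (1 - q)⁻¹ * (q ^ r / c) := by
    intro v
    rw [← tsum_outWeight_fiber φ (PathBridge h) (fun _ _ p => p.length),
      ← ENNReal.tsum_geometric, ← ENNReal.tsum_mul_right]
    refine ENNReal.tsum_le_tsum fun n => ?_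
    refine (outWeight_mono φ fun _ _ hp => (⟨⟨hp.1.1, hp.2⟩, hp.1.2⟩ : BridgeOfLength h n _)).trans
      ((hlen n v).trans_eq ?_)
    rw [pow_add, mul_div_assoc]
  have hB : (1 - q)⁻¹ * (q ^ r / c) ≠ ⊤ := by
    refine ENNReal.mul_ne_top (ENNReal.inv_ne_top.2 (tsub_pos_of_lt hq).ne') ?_
    exact ENNReal.div_ne_top (by finiteness) hc
  obtain ⟨M, hM, hMn⟩ := exists_outWeight_sawOfLength_le hG hH hφ hB hbridge root
  refine ⟨M.toReal, fun n => ?_⟩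
  rw [sawWeight, ← ENNReal.ofReal_le_ofReal_iff ENNReal.toReal_nonneg,
    ofReal_totalWeight_saws hφ.pos, ENNReal.ofReal_toReal hM]
  exact hMn n

/-! ### Scaling the edge weight, and the conclusion -/

theorem walkWeight_const_mul (φ : Sym2 V → ℝ) (z : ℝ) {u v : V} (p : G.Walk u v) :
    walkWeight (fun e => z * φ e) p = z ^ p.length * walkWeight φ p := by
  rw [walkWeight, walkWeight, List.prod_map_mul, List.map_const', List.prod_replicate,
    Walk.length_edges]

theorem totalWeight_const_mul (φ : Sym2 V → ℝ) (z : ℝ) {n : ℕ} {v : V}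
    {S : Set (Σ w : V, G.Walk v w)} (hS : ∀ p ∈ S, p.2.length = n) :
    totalWeight (fun e => z * φ e) S = z ^ n * totalWeight φ S := by
  rw [totalWeight, totalWeight, ← tsum_mul_left]
  refine tsum_congr fun p => ?_
  rw [walkWeight_const_mul, hS p.1 p.2]

theorem IsInvariantEdgeWeight.const_mul {H : Subgroup (G ≃g G)} {φ : Sym2 V → ℝ}
    (hφ : IsInvariantEdgeWeight G H φ) {z : ℝ} (hz : 0 < z) :
    IsInvariantEdgeWeight G H fun e => z * φ e :=
  ⟨fun e he => mul_pos hz (hφ.pos e he), fun α hα u v huv => by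
    rw [hφ.invariant α hα u v huv]⟩

end WeightedSAW

open WeightedSAW in
theorem theorem2p4 {V : Type*} [Infinite V] (G : SimpleGraph V) [G.LocallyFinite]
    (hG : G.Connected) (root : V) (h : V → ℤ) (H : Subgroup (G ≃g G))
    (hH : WeightedSAW.IsUnimodularGraphHeightFunction G root h H)
    (φ : Sym2 V → ℝ) (hφ : WeightedSAW.IsInvariantEdgeWeight G H φ) :
    Tendsto (fun n : ℕ => WeightedSAW.sawWeight G φ root n ^ (1 / (n : ℝ))) atTop
        (𝓝 (WeightedSAW.connectiveConstant G φ root)) ∧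
      Tendsto (fun n : ℕ => WeightedSAW.bridgeWeight G φ h n ^ (1 / (n : ℝ))) atTop
        (𝓝 (WeightedSAW.bridgeConstant G φ h)) ∧
      0 < WeightedSAW.connectiveConstant G φ root ∧
      WeightedSAW.bridgeConstant G φ h = WeightedSAW.connectiveConstant G φ root := by
  obtain ⟨K, hK⟩ := exists_sawWeight_le_pow hH.quasiTransitive hφ root
  have hpos := bridgeWeight_pos hH.toIsGraphHeightFunction hφ
  have hle := bridgeWeight_le_sawWeight hφ.pos root h
  obtain ⟨β, hβ, hlim, hpow⟩ := exists_tendsto_root_of_supermultiplicative hpos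
    (bridgeWeight_mul_le hφ.pos h) fun n => (hle n).trans (hK n)
  have hsaw : Tendsto (fun n : ℕ => sawWeight G φ root n ^ (1 / (n : ℝ))) atTop (𝓝 β) := by
    refine tendsto_root_of_le hβ hpos hle hlim fun z hz hzβ => ?_
    -- The subcritical case is applied to the weight `z * φ` with rate `ρ = z * β`.
    obtain ⟨M, hM⟩ := exists_sawWeight_le_of_bridgeWeight_le hG hH (hφ.const_mul hz) hzβ
      fun n => by
        have e : bridgeWeight G (fun e => z * φ e) h n = z ^ n * bridgeWeight G φ h n := by
          rw [bridgeWeight, bridgeWeight, Real.mul_iInf_of_nonneg (pow_nonneg hz.le n)]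
          exact iInf_congr fun v => totalWeight_const_mul φ z fun p hp => hp.1.2
        rw [e, mul_pow]
        exact mul_le_mul_of_nonneg_left (hpow n) (pow_nonneg hz.le n)
    refine ⟨M, fun n => ?_⟩
    rw [sawWeight, ← totalWeight_const_mul φ z fun p hp => hp.2]
    exact hM n
  have e1 : connectiveConstant G φ root = β := hsaw.limUnder_eq
  have e2 : bridgeConstant G φ h = β := hlim.limUnder_eq
  rw [e1, e2]
  exact ⟨hsaw, hlim, hβ, rfl⟩
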